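/- Let $k\ge 1$ and let $n_1,\dots,n_k$ be positive integers with $n_1+\dots+n_k\ge 2$. Let $V=\{(i,v): 1\le i\le k,\ 1\le v\le n_i\}$ be the set of vertices, partitioned into blocks by the first entry, and let $E$ be the set of all unordered pairs $xy=\{x,y\}$ of distinct elements of $V$. For $u\in\mathbb{C}^{E}$, the likelihood equations of the $\beta$-stochastic blockmodel $\mathcal{M}(n_1,\dots,n_k)$ in the unknown $p\in\mathbb{C}^{E}$ (where $p_{xy}=p_{yx}$ denotes the coordinate of the pair $\{x,y\}$) are: * the linear equations $A(p-u)=0$, where $A$ is the zero-one design matrix with columns indexed by $E$, one row for each vertex $x\in V$ (with entry $1$ in column $e$ iff $x\in e$), and one row for each unordered pair $\{\ell_1,\ell_2\}$ of not necessarily distinct blocks (with entry $1$ in column $\{(i,v),(j,w)\}$ iff $\{i,j\}=\{\ell_1,\ell_2\}$); * the quadratic equations, for pairwise distinct blocks $i,j,l$ and pairwise distinct vertices, $$p_{(i,t)(i,s)}\,p_{(i,v)(i,w)}-p_{(i,t)(i,v)}\,p_{(i,s)(i,w)}=0,$$ $$p_{(i,t)(j,w)}\,p_{(i,s)(i,v)}-p_{(i,t)(i,s)}\,p_{(i,v)(j,w)}=0,$$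 $$p_{(i,t)(j,v)}\,p_{(i,s)(j,w)}-p_{(i,t)(j,w)}\,p_{(i,s)(j,v)}=0,$$ $$p_{(i,t)(j,v)}\,p_{(i,s)(l,w)}-p_{(i,t)(l,w)}\,p_{(i,s)(j,v)}=0.$$ The maximum likelihood degree $\operatorname{MLdeg}(n_1,\dots,n_k)$ is the number of solutions $p\in\mathbb{C}^{E}$ of the likelihood equations for generic $u\in\mathbb{C}^{E}$, i.e. for all $u$ outside the zero set of some nonzero polynomial. **Theorem.** The maximum likelihood degree is well defined: for all positive integers $n_1,\dots,n_k$ with $n_1+\dots+n_k\ge2$, the number of solutions is finite and the same for all generic $u$. Moreover: 1. for every integer $n>1$, $\operatorname{MLdeg}(n)=1$ if $n=2$, and $\operatorname{MLdeg}(n)=2^{n-1}-n$ if $n>2$; 2. for every positive integer $n_1$, $\operatorname{MLdeg}(n_1,1)=\operatorname{MLdeg}(n_1+1)$; 3. for all integers $k>1$ and all positive integers $n_1,\dots,n_k$, $$\operatorname{MLdeg}(n_1,\dots,n_k)=\prod_{i=1}^{k}\operatorname{MLdeg}(n_i,1).$$ -/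

import Mathlib

namespace BetaSBM

/-- The vertices `(i, v)`, with `v` one of the `n i` vertices of block `i`. -/
abbrev Vertex {k : ℕ} (n : Fin k → ℕ) : Type := Σ i : Fin k, Fin (n i)

/-- The dyads (potential undirected edges): unordered pairs of distinct vertices. -/
abbrev Dyad {k : ℕ} (n : Fin k → ℕ) : Type := {e : Sym2 (Vertex n) // ¬ e.IsDiag}

/-- The dyad joining two distinct vertices. -/
def dyad {k : ℕ} {n : Fin k → ℕ} (x y : Vertex n) (h : x ≠ y) : Dyad n :=
  ⟨s(x, y), fun hd => h (Sym2.mk_isDiag_iff.mp hd)⟩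

/-- The coordinate `p_{xy}` of a vector indexed by dyads, with the convention `p_{xx} = 0`.
It is only used at pairs of distinct vertices. -/
def coord {k : ℕ} {n : Fin k → ℕ} (p : Dyad n → ℂ) (x y : Vertex n) : ℂ :=
  if h : x ≠ y then p (dyad x y h) else 0

/-- The design matrix. The rows are indexed by the parameters: `Sum.inl x` is the row of the
vertex parameter of `x`, and `Sum.inr s` is the row of the block parameter of the unordered pair
`s` of (possibly equal) blocks. The columns are indexed by the dyads. -/
def designMatrix {k : ℕ} (n : Fin k → ℕ) :
    Matrix (Vertex n ⊕ Sym2 (Fin k)) (Dyad n) ℂ :=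
  fun r e => match r with
    | Sum.inl x => if x ∈ e.1 then 1 else 0
    | Sum.inr s => if Sym2.map Sigma.fst e.1 = s then 1 else 0

/-- Quadratic equations on four distinct vertices of one block. -/
def WithinBlock {k : ℕ} {n : Fin k → ℕ} (p : Dyad n → ℂ) : Prop :=
  ∀ (i : Fin k) (t u v w : Fin (n i)),
    t ≠ u → t ≠ v → t ≠ w → u ≠ v → u ≠ w → v ≠ w →
    coord p ⟨i, t⟩ ⟨i, u⟩ * coord p ⟨i, v⟩ ⟨i, w⟩
      - coord p ⟨i, t⟩ ⟨i, v⟩ * coord p ⟨i, u⟩ ⟨i, w⟩ = 0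

/-- Quadratic equations on three distinct vertices of one block and one vertex of another. -/
def ThreeOne {k : ℕ} {n : Fin k → ℕ} (p : Dyad n → ℂ) : Prop :=
  ∀ (i j : Fin k), i ≠ j → ∀ (t u v : Fin (n i)) (w : Fin (n j)),
    t ≠ u → t ≠ v → u ≠ v →
    coord p ⟨i, t⟩ ⟨j, w⟩ * coord p ⟨i, u⟩ ⟨i, v⟩
      - coord p ⟨i, t⟩ ⟨i, u⟩ * coord p ⟨i, v⟩ ⟨j, w⟩ = 0

/-- Quadratic equations on two distinct vertices of one block and two distinct vertices of
another. -/
def TwoTwo {k : ℕ} {n : Fin k → ℕ} (p : Dyad n → ℂ) : Prop :=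
  ∀ (i j : Fin k), i ≠ j → ∀ (t u : Fin (n i)) (v w : Fin (n j)),
    t ≠ u → v ≠ w →
    coord p ⟨i, t⟩ ⟨j, v⟩ * coord p ⟨i, u⟩ ⟨j, w⟩
      - coord p ⟨i, t⟩ ⟨j, w⟩ * coord p ⟨i, u⟩ ⟨j, v⟩ = 0

/-- Quadratic equations on two distinct vertices of one block and one vertex in each of two
further blocks. -/
def TwoOneOne {k : ℕ} {n : Fin k → ℕ} (p : Dyad n → ℂ) : Prop :=
  ∀ (i j l : Fin k), i ≠ j → i ≠ l → j ≠ l →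
    ∀ (t u : Fin (n i)) (v : Fin (n j)) (w : Fin (n l)), t ≠ u →
    coord p ⟨i, t⟩ ⟨j, v⟩ * coord p ⟨i, u⟩ ⟨l, w⟩
      - coord p ⟨i, t⟩ ⟨l, w⟩ * coord p ⟨i, u⟩ ⟨j, v⟩ = 0

/-- The complex solutions of the likelihood equations of the `β`-stochastic blockmodel with
block sizes `n`, for the data vector `u`. -/
def likelihoodSolutions {k : ℕ} (n : Fin k → ℕ) (u : Dyad n → ℂ) : Set (Dyad n → ℂ) :=
  {p | (designMatrix n).mulVec (p - u) = 0 ∧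
    WithinBlock p ∧ ThreeOne p ∧ TwoTwo p ∧ TwoOneOne p}

/-- For generic data `u`, that is, for all `u` outside the zero set of some nonzero polynomial,
the likelihood equations have exactly `d` complex solutions. -/
def HasMLDegree {k : ℕ} (n : Fin k → ℕ) (d : ℕ) : Prop :=
  ∃ f : MvPolynomial (Dyad n) ℂ, f ≠ 0 ∧
    ∀ u : Dyad n → ℂ, MvPolynomial.eval u f ≠ 0 →
      (likelihoodSolutions n u).encard = (d : ℕ∞)

/-- The generic number of solutions is unique if it exists. -/
theorem HasMLDegree.unique {k : ℕ} {n : Fin k → ℕ} {d d' : ℕ}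
    (h : HasMLDegree n d) (h' : HasMLDegree n d') : d = d' := by
  obtain ⟨f, hf, hd⟩ := h
  obtain ⟨g, hg, hd'⟩ := h'
  have hfg : ∃ u : Dyad n → ℂ, MvPolynomial.eval u (f * g) ≠ 0 := by
    by_contra hcon
    push Not at hcon
    exact mul_ne_zero hf hg (MvPolynomial.funext fun u => by rw [hcon u, map_zero])
  obtain ⟨u, hu⟩ := hfg
  rw [map_mul] at hu
  have h1 := hd u (left_ne_zero_of_mul hu)
  rw [hd' u (right_ne_zero_of_mul hu)] at h1
  exact_mod_cast h1.symm

open Classical in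
/-- The maximum likelihood degree of the `β`-stochastic blockmodel with block sizes `n`: the
number of complex solutions of the likelihood equations for generic data (and `0` if there were
no such number). -/
noncomputable def MLdeg {k : ℕ} (n : Fin k → ℕ) : ℕ :=
  if h : ∃ d, HasMLDegree n d then h.choose else 0

end BetaSBM

/-!
The count reduces to a single block, and for a single block to the number of roots of one
polynomial.

**Splitting.** Collapse all vertices outside block `i` to one extra vertex; the entry from a vertex
of the block to the extra vertex is the sum `crossSum` of its entries to the other blocks. The
quadratic equations say precisely that the collapsed tables solve the equations of a single block
with `n i + 1` vertices (`blockTable_mem`) and that the entries between two blocks have rank one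
and are recovered from the collapsed tables and the block sums, provided the sums `outSum` do not
vanish (`coord_mul_outSum`, `ofTable_glue_mem`). Hence the solution set is the product of the
solution sets of the single blocks (`bijOn_blockTable`). The row sums of a collapsed table are
generic because they depend linearly and surjectively on the data (`blockDataLinear_surjective`);
a block with one vertex gives two vertices after collapsing and has exactly one solution.

**One block with `n ≥ 3` vertices.** For generic row sums `c`, no entry of a solution vanishes
(`blockSolutions_ne_zero`), so a solution has the form `q x y = θ x * θ y`, with `θ` unique up to
sign. With `S = ∑ x, θ x` the equations become `θ x * (S - θ x) = c x`, that is,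
`θ x = (S ± √(S² - 4 c x)) / 2`, and the condition that the `θ x` sum to `S` reads
`(n - 2) S + ∑ x, ± √(S² - 4 c x) = 0` for some choice of signs. The product of the left sides over
all `2 ^ n` choices of signs is a polynomial `elimPoly c` in `s = S²`. It remains to see that
solutions correspond to roots, and to count roots.

* The degree is `2 ^ (n - 1) - n` (`natDegree_elimPoly`): in the variable `1 / s` the factors are
  power series, and exactly the `n` factors with a single plus sign vanish at the origin, to first
  order.
* The derivative at a root is computed with dual numbers, in which the square roots extend. If two
  factors vanish at the same root, the root is multiple, so a simple root comes from one solution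
  only (`eq_or_eq_neg_of_sq_sum_eq`).
* For generic `c` all roots are simple (`generically_elimPoly`). Over the algebraic closure of the
  field of rational functions in the `c x`, the partial derivatives `∂/∂c x` extend to derivations;
  applied to the linear relation between the square roots they show that the factor has nonzero
  derivative and that no other factor vanishes (`derivative_elimPoly_ne_zero_of_derivation`). A
  Bézout identity with cleared denominators carries separability over to generic complex `c`.
-/

namespace BetaSBM

/-! ### The norm of a sum of square roots -/

section SignProd

variable {V : Type} [Fintype V] [DecidableEq V]

/-- The product of the conjugates `t + ∑ x, ± r x` over all choices of signs. -/
def signProd {B : Type} [CommRing B] (t : B) (r : V → B) : B :=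
  ∏ ε : V → ℤˣ, (t + ∑ x, ((ε x : ℤ) : B) * r x)

theorem map_signProd {B B' : Type} [CommRing B] [CommRing B'] (φ : B →+* B') (t : B)
    (r : V → B) : φ (signProd t r) = signProd (φ t) (fun x => φ (r x)) := by
  simp [signProd, map_prod, map_sum]

theorem signProd_sign_mul {B : Type} [CommRing B] (t : B) (r : V → B) (η : V → ℤˣ) :
    signProd t (fun x => ((η x : ℤ) : B) * r x) = signProd t r := by
  unfold signProd
  refine Fintype.prod_equiv (Equiv.mulRight η) _ _ fun ε => ?_
  simp [mul_assoc]

theorem signProd_neg [Nonempty V] {B : Type} [CommRing B] (t : B) (r : V → B) :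
    signProd (-t) r = signProd t r := by
  have h : signProd (-t) r = ∏ ε : V → ℤˣ, -(t + ∑ x, ((ε x : ℤ) : B) * r x) := by
    unfold signProd
    refine Fintype.prod_equiv (Equiv.neg (V → ℤˣ)) _ _ fun ε => ?_
    simp [Finset.sum_neg_distrib, add_comm]
  have hc : Even (Finset.univ : Finset (V → ℤˣ)).card := by
    rw [Finset.card_univ, Fintype.card_fun, Fintype.card_units_int]
    exact Nat.even_pow.mpr ⟨even_two, Fintype.card_ne_zero⟩
  rw [h, Finset.prod_neg, hc.neg_one_pow, one_mul]
  rfl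

/-- A homogeneous scaling of all square roots. -/
theorem signProd_mul {B : Type} [CommRing B] (a t : B) (r : V → B) :
    signProd (a * t) (fun x => a * r x) = a ^ 2 ^ Fintype.card V * signProd t r := by
  unfold signProd
  rw [← Fintype.card_units_int, ← Fintype.card_fun, ← Finset.card_univ, ← Finset.prod_const,
    ← Finset.prod_mul_distrib]
  refine Finset.prod_congr rfl fun ε _ => ?_
  rw [mul_add, Finset.mul_sum]
  exact congrArg _ (Finset.sum_congr rfl fun x _ => by ring)

/-- A polynomial that is even in each variable separately is a polynomial in the squares. -/
theorem exists_expand_two_eq {σ : Type} [DecidableEq σ] (q : MvPolynomial σ ℂ)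
    (h : ∀ i, MvPolynomial.aeval
      (fun j => if j = i then -MvPolynomial.X j else (MvPolynomial.X j : MvPolynomial σ ℂ)) q = q) :
    ∃ q' : MvPolynomial σ ℂ, MvPolynomial.expand 2 q' = q := by
  have hcoeff : ∀ (i : σ) (q : MvPolynomial σ ℂ) (m : σ →₀ ℕ), (MvPolynomial.aeval
      (fun j => if j = i then -MvPolynomial.X j else (MvPolynomial.X j : MvPolynomial σ ℂ))
        q).coeff m = (-1) ^ m i * q.coeff m := by
    intro i q m
    induction q using MvPolynomial.induction_on' with
    | add p q hp hq => rw [map_add, MvPolynomial.coeff_add, hp, hq, MvPolynomial.coeff_add, mul_add]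
    | monomial d a =>
      have hd : (MvPolynomial.aeval
          (fun j => if j = i then -MvPolynomial.X j else (MvPolynomial.X j : MvPolynomial σ ℂ))
          (MvPolynomial.monomial d a)) = MvPolynomial.C ((-1) ^ d i) * MvPolynomial.monomial d a := by
        rw [MvPolynomial.aeval_monomial, MvPolynomial.monomial_eq, MvPolynomial.algebraMap_eq]
        have : ∀ j, (if j = i then -MvPolynomial.X j else (MvPolynomial.X j : MvPolynomial σ ℂ))
            = (if j = i then -1 else 1) * MvPolynomial.X j := by
          intro j; split_ifs <;> simp
        simp_rw [Finsupp.prod, this, mul_pow, Finset.prod_mul_distrib]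
        have h2 : (∏ j ∈ d.support, ((if j = i then -1 else 1 : MvPolynomial σ ℂ)) ^ d j)
            = (-1) ^ d i := by
          rw [Finset.prod_eq_single i]
          · simp
          · intro j _ hj; simp [hj]
          · intro hi; simp [Finsupp.notMem_support_iff.mp hi]
        rw [h2]
        simp only [map_pow, map_neg, map_one]
        ring
      rw [hd, MvPolynomial.coeff_C_mul, MvPolynomial.coeff_monomial]
      split_ifs with hm
      · rw [hm]
      · simp
  have heven : ∀ m ∈ q.support, ∀ i, Even (m i) := by
    intro m hm i
    by_contra hodd
    have := hcoeff i q m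
    rw [h i, (Nat.not_even_iff_odd.mp hodd).neg_one_pow] at this
    exact MvPolynomial.mem_support_iff.mp hm (by linear_combination this / 2)
  refine ⟨∑ m ∈ q.support,
    MvPolynomial.monomial (m.mapRange (· / 2) rfl) (q.coeff m), ?_⟩
  rw [map_sum]
  conv_rhs => rw [MvPolynomial.as_sum q]
  refine Finset.sum_congr rfl fun m hm => ?_
  rw [MvPolynomial.expand_monomial]
  congr 1
  congr 1
  ext i
  simp [Nat.two_mul_div_two_of_even (heven m hm i)]

/-- The universal polynomial for products of conjugates: evaluated at squares, it gives the
product `signProd` of their square roots. It exists because the product is even in each of the roots. -/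
theorem exists_signNorm (V : Type) [Fintype V] [DecidableEq V] [Nonempty V] :
    ∃ P : MvPolynomial (Option V) ℂ, ∀ (B : Type) [CommRing B] [Algebra ℂ B] (t : B) (r : V → B),
      MvPolynomial.aeval (fun o => o.elim (t ^ 2) fun x => r x ^ 2) P = signProd t r := by
  have key : ∀ (B : Type) [CommRing B] [Algebra ℂ B] (f : Option V → B),
      MvPolynomial.aeval f (signProd (MvPolynomial.X none)
        (fun x => MvPolynomial.X (some x)) : MvPolynomial (Option V) ℂ)
      = signProd (f none) (fun x => f (some x)) := by
    intro B _ _ f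
    have := map_signProd (MvPolynomial.aeval (R := ℂ) f).toRingHom (MvPolynomial.X none)
        (fun x : V => MvPolynomial.X (some x))
    simpa using this
  obtain ⟨P, hP⟩ := exists_expand_two_eq (signProd (MvPolynomial.X none)
    (fun x => MvPolynomial.X (some x)) : MvPolynomial (Option V) ℂ) (by
      intro o
      rw [key]
      cases o with
      | none => simpa using signProd_neg _ _
      | some x =>
        rw [← signProd_sign_mul _ (fun x => MvPolynomial.X (some x)) (Function.update 1 x (-1))]
        simp only [reduceCtorEq, if_false, Option.some.injEq]
        congr 1
        ext1 y
        by_cases hy : y = x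
        · subst hy; simp
        · simp [hy])
  refine ⟨P, fun B _ _ t r => ?_⟩
  have h := key B (fun o => o.elim t r)
  rw [← hP] at h
  simp only [Option.elim] at h
  rw [← h, MvPolynomial.expand, MvPolynomial.aeval_bind₁]
  congr 2
  ext1 o
  cases o <;> simp

/-- The polynomial in the squares of `t` and of the `r x` that equals the product of all
`t + ∑ x, ± r x`. -/
noncomputable def signNorm (V : Type) [Fintype V] [DecidableEq V] [Nonempty V] :
    MvPolynomial (Option V) ℂ :=
  (exists_signNorm V).choose

theorem aeval_signNorm [Nonempty V] {B : Type} [CommRing B] [Algebra ℂ B] (t : B) (r : V → B) :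
    MvPolynomial.aeval (fun o => o.elim (t ^ 2) fun x => r x ^ 2) (signNorm V) = signProd t r :=
  (exists_signNorm V).choose_spec B t r

end SignProd

/-! ### The elimination polynomial -/

section ElimPoly

variable {V : Type} [Fintype V] [DecidableEq V] [Nonempty V]

/-- The polynomial in `s` obtained by eliminating the square roots from
`(n - 2) √s + ∑ x, ± √(s - 4 c x) = 0`, where `n` is the number of vertices. -/
noncomputable def elimPoly {B : Type} [CommRing B] [Algebra ℂ B] (c : V → B) : Polynomial B :=
  MvPolynomial.aeval (fun o => o.elim (((Fintype.card V : Polynomial B) - 2) ^ 2 * Polynomial.X)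
    fun x => Polynomial.X - Polynomial.C (4 * c x)) (signNorm V)

theorem map_elimPoly {B B' : Type} [CommRing B] [Algebra ℂ B] [CommRing B'] [Algebra ℂ B']
    (φ : B →ₐ[ℂ] B') (c : V → B) :
    (elimPoly c).map φ.toRingHom = elimPoly (fun x => φ (c x)) := by
  have := MvPolynomial.map_aeval (fun o : Option V =>
    o.elim (((Fintype.card V : Polynomial B) - 2) ^ 2 * Polynomial.X)
    fun x => Polynomial.X - Polynomial.C (4 * c x)) (Polynomial.mapRingHom φ.toRingHom) (signNorm V)
  rw [elimPoly, ← Polynomial.coe_mapRingHom, this, elimPoly, MvPolynomial.aeval_def,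
    MvPolynomial.coe_eval₂Hom]
  congr 1
  · ext a : 1
    simp [Polynomial.algebraMap_apply]
  · have h4 : φ 4 = 4 := map_ofNat φ 4
    ext1 o
    cases o <;> simp [h4]

theorem eval_elimPoly {B : Type} [CommRing B] [Algebra ℂ B] {c r : V → B} {s S : B}
    (hS : S ^ 2 = s) (hr : ∀ x, r x ^ 2 = s - 4 * c x) :
    (elimPoly c).eval s = signProd (((Fintype.card V : B) - 2) * S) r := by
  rw [← aeval_signNorm, elimPoly]
  have := MvPolynomial.map_aeval (fun o : Option V =>
    o.elim (((Fintype.card V : Polynomial B) - 2) ^ 2 * Polynomial.X)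
    fun x => Polynomial.X - Polynomial.C (4 * c x)) (Polynomial.evalRingHom s) (signNorm V)
  rw [← Polynomial.coe_evalRingHom, this, MvPolynomial.aeval_def, MvPolynomial.coe_eval₂Hom]
  congr 1
  · ext a : 1
    simp [Polynomial.algebraMap_apply]
  · ext1 o
    cases o <;> simp [hr, mul_pow, hS]

end ElimPoly

/-! ### The derivative of the elimination polynomial at a root -/

section Derivative

variable {V : Type} [Fintype V] [DecidableEq V]
variable {L : Type} [Field L] [Algebra ℂ L]

open TrivSqZeroExt

/-- The derivative is read off in the dual numbers, where the square roots `S` and `r x` extend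
to `S + ε / (2 S)` and `r x + ε / (2 r x)`. -/
theorem eval_derivative_elimPoly [Nonempty V] {c r : V → L} {s S : L} (hS : S ^ 2 = s)
    (hr : ∀ x, r x ^ 2 = s - 4 * c x) (hS0 : S ≠ 0) (hr0 : ∀ x, r x ≠ 0) :
    (elimPoly c).derivative.eval s = snd (∏ ε : V → ℤˣ,
      (inl (((Fintype.card V : L) - 2) * S + ∑ x, ((ε x : ℤ) : L) * r x) +
        inr ((((Fintype.card V : L) - 2) / S + ∑ x, ((ε x : ℤ) : L) / r x) / 2) :
          TrivSqZeroExt L L)) := by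
  have : CharZero L := charZero_of_injective_algebraMap (algebraMap ℂ L).injective
  have two : (2 : TrivSqZeroExt L L) = inl 2 := (map_ofNat (inlHom L L) 2).symm
  have four : (4 : TrivSqZeroExt L L) = inl 4 := (map_ofNat (inlHom L L) 4).symm
  have h1 := eval_elimPoly (B := TrivSqZeroExt L L) (c := fun x => inl (c x))
    (r := fun x => inl (r x) + inr (1 / (2 * r x))) (s := inl s + inr 1)
    (S := inl S + inr (1 / (2 * S)))
    (by
      ext
      · simp [hS]
      · simp; field_simp)
    (fun x => by
      have := hr0 x
      ext
      · simp [hr, four]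
      · simp [four]; field_simp)
  have h2 := map_elimPoly (inlAlgHom ℂ L L) c
  have h3 := Polynomial.aeval_add_of_sq_eq_zero (S := TrivSqZeroExt L L) (elimPoly c)
    (inl s) (inr 1) (by ext <;> simp)
  have h4 : Polynomial.aeval (inl s + inr 1 : TrivSqZeroExt L L) (elimPoly c) =
      (elimPoly (fun x => (inl (c x) : TrivSqZeroExt L L))).eval (inl s + inr 1) := by
    rw [Polynomial.aeval_def, ← Polynomial.eval_map]
    exact congrArg _ h2
  have h5 : ∀ p : Polynomial L, Polynomial.aeval (inl s : TrivSqZeroExt L L) p =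
      inl (p.eval s) := fun p => by
    have := Polynomial.aeval_algebraMap_apply (TrivSqZeroExt L L) s p
    rwa [Polynomial.coe_aeval_eq_eval] at this
  have h6 : (elimPoly c).derivative.eval s =
      snd (Polynomial.aeval (inl s + inr 1 : TrivSqZeroExt L L) (elimPoly c)) := by
    rw [h3, h5, h5]
    simp
  rw [h6, h4, h1, signProd]
  congr 1
  refine Finset.prod_congr rfl fun ε _ => ?_
  have hn : (((Fintype.card V : TrivSqZeroExt L L)) - 2) = inl ((Fintype.card V : L) - 2) := by
    ext <;> simp [two]
  have hz : ∀ z : ℤ, ((z : TrivSqZeroExt L L)) = inl (z : L) := fun z => by ext <;> simp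
  rw [hn]
  simp_rw [hz]
  ext
  · simp [fst_sum]
  · simp only [snd_add, snd_mul, snd_inl, snd_inr, fst_inl, snd_sum, fst_add, fst_inr, smul_eq_mul,
      MulOpposite.smul_eq_mul_unop, zero_add, add_div, Finset.sum_div]
    simp
    congr 1
    · field_simp
    · refine Finset.sum_congr rfl fun x _ => ?_
      have := hr0 x
      field_simp

/-- If two different choices of signs both give zero, the root is multiple. -/
theorem derivative_elimPoly_eq_zero [Nonempty V] {c r : V → L} {s S : L} (hS : S ^ 2 = s)
    (hr : ∀ x, r x ^ 2 = s - 4 * c x) (hS0 : S ≠ 0) (hr0 : ∀ x, r x ≠ 0)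
    {ε ε' : V → ℤˣ} (hne : ε ≠ ε')
    (h : ((Fintype.card V : L) - 2) * S + ∑ x, ((ε x : ℤ) : L) * r x = 0)
    (h' : ((Fintype.card V : L) - 2) * S + ∑ x, ((ε' x : ℤ) : L) * r x = 0) :
    (elimPoly c).derivative.eval s = 0 := by
  rw [eval_derivative_elimPoly hS hr hS0 hr0, ← Finset.mul_prod_erase _ _ (Finset.mem_univ ε),
    ← Finset.mul_prod_erase _ _ (Finset.mem_erase.mpr ⟨hne.symm, Finset.mem_univ ε'⟩)]
  simp [h, h']

/-- If exactly one choice of signs gives zero, and the derivative of that factor does not vanish,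
the root is simple. -/
theorem derivative_elimPoly_ne_zero [Nonempty V] {c r : V → L} {s S : L} (hS : S ^ 2 = s)
    (hr : ∀ x, r x ^ 2 = s - 4 * c x) (hS0 : S ≠ 0) (hr0 : ∀ x, r x ≠ 0)
    {ε : V → ℤˣ}
    (h : ((Fintype.card V : L) - 2) * S + ∑ x, ((ε x : ℤ) : L) * r x = 0)
    (h' : ∀ ε', ε' ≠ ε → ((Fintype.card V : L) - 2) * S + ∑ x, ((ε' x : ℤ) : L) * r x ≠ 0)
    (hd : ((Fintype.card V : L) - 2) / S + ∑ x, ((ε x : ℤ) : L) / r x ≠ 0) :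
    (elimPoly c).derivative.eval s ≠ 0 := by
  have : CharZero L := charZero_of_injective_algebraMap (algebraMap ℂ L).injective
  rw [eval_derivative_elimPoly hS hr hS0 hr0, ← Finset.mul_prod_erase _ _ (Finset.mem_univ ε)]
  simp only [h, snd_mul, inl_zero, zero_add, fst_inr, zero_smul, snd_inr,
    MulOpposite.smul_eq_mul_unop, MulOpposite.unop_op]
  refine mul_ne_zero (div_ne_zero hd two_ne_zero) ?_
  rw [show ∀ a : TrivSqZeroExt L L, fst a = fstHom L L L a from fun _ => rfl, map_prod]
  refine Finset.prod_ne_zero_iff.mpr fun ε' hε' => ?_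
  simpa using h' ε' (Finset.ne_of_mem_erase hε')

/-- A linear relation between the square roots, differentiated. -/
theorem derivation_sqrt_relation {c r : V → L} {s S : L} (hS : S ^ 2 = s)
    (hr : ∀ x, r x ^ 2 = s - 4 * c x) (hS0 : S ≠ 0) (hr0 : ∀ x, r x ≠ 0)
    (D : Derivation ℂ L L) {x : V} (hD : ∀ y, D (c y) = if y = x then 1 else 0)
    (κ : ℤ) (η : V → ℤ) (h : (κ : L) * S + ∑ y, (η y : L) * r y = 0) :
    D s * ((κ : L) / S + ∑ y, (η y : L) / r y) = 4 * (η x : L) / r x := by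
  have : CharZero L := charZero_of_injective_algebraMap (algebraMap ℂ L).injective
  have hDS : D S = D s / (2 * S) := by
    have := congrArg D hS
    rw [pow_two, D.leibniz] at this
    field_simp
    rw [← this]; simp; ring
  have hD4 : D (4 : L) = 0 := by
    have := D.map_natCast 4
    exact_mod_cast this
  have hDr : ∀ y, D (r y) = (D s - 4 * if y = x then 1 else 0) / (2 * r y) := by
    intro y
    have := congrArg D (hr y)
    have hy := hr0 y
    rw [pow_two, D.leibniz, map_sub, D.leibniz, hD, hD4] at this
    field_simp
    simp only [smul_eq_mul, mul_zero, add_zero] at this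
    rw [← this]; ring
  have hDz : ∀ z : ℤ, D (z : L) = 0 := fun z => by simp
  have h2 := congrArg D h
  simp only [map_add, map_sum, D.leibniz, hDz, hDS, hDr, map_zero,
    smul_eq_mul, mul_zero, add_zero] at h2
  have h3 : ∑ y, (η y : L) * ((D s - 4 * if y = x then 1 else 0) / (2 * r y))
      = D s / 2 * ∑ y, (η y : L) / r y - 2 * (η x : L) / r x := by
    have : ∀ y, (η y : L) * ((D s - 4 * if y = x then 1 else 0) / (2 * r y))
      = D s / 2 * ((η y : L) / r y) - if y = x then 2 * (η y : L) / r y else 0 := by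
      intro y
      have hy := hr0 y
      split_ifs <;> field_simp <;> ring
    simp_rw [this, Finset.sum_sub_distrib, ← Finset.mul_sum]
    simp
  rw [h3] at h2
  linear_combination 2 * h2 + D s * κ * (by field_simp; ring : (1 : L) / S - 2 * (1 / (2 * S)) = 0)

/-- Over a field in which the degrees `c x` are differentially independent, every root of the
elimination polynomial is simple: a second vanishing factor, or a vanishing derivative, would
contradict the differentiated relation. -/
theorem derivative_elimPoly_ne_zero_of_derivation [Nonempty V] (hV : 3 ≤ Fintype.card V) [IsAlgClosed L]
    {c : V → L} (D : V → Derivation ℂ L L) (hD : ∀ x y, D x (c y) = if y = x then 1 else 0)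
    {s : L} (hs0 : s ≠ 0) (hsc : ∀ x, s ≠ 4 * c x) (hs : (elimPoly c).eval s = 0) :
    (elimPoly c).derivative.eval s ≠ 0 := by
  have : CharZero L := charZero_of_injective_algebraMap (algebraMap ℂ L).injective
  obtain ⟨S, hS⟩ := IsAlgClosed.exists_pow_nat_eq s (n := 2) two_pos
  have hS0 : S ≠ 0 := by rintro rfl; exact hs0 (by simpa using hS.symm)
  choose r₀ hr₀ using fun x => IsAlgClosed.exists_pow_nat_eq (s - 4 * c x) (n := 2) two_pos
  have hs' := hs
  rw [eval_elimPoly hS hr₀, signProd, Finset.prod_eq_zero_iff] at hs'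
  obtain ⟨ε₀, -, hε₀⟩ := hs'
  -- the signs are absorbed into the choice of the square roots
  obtain ⟨r, hr, h⟩ : ∃ r : V → L, (∀ x, r x ^ 2 = s - 4 * c x) ∧
      ((Fintype.card V : L) - 2) * S + ∑ x, r x = 0 := by
    refine ⟨fun x => ((ε₀ x : ℤ) : L) * r₀ x, fun x => ?_, hε₀⟩
    rw [mul_pow, hr₀]
    rcases Int.units_eq_one_or (ε₀ x) with hx | hx <;> simp [hx]
  have hr0 : ∀ x, r x ≠ 0 := by
    intro x hx
    refine hsc x ?_
    have := hr x
    rw [hx] at this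
    linear_combination -this
  have hκ : ((Fintype.card V - 2 : ℤ) : L) = (Fintype.card V : L) - 2 := by push_cast; rfl
  refine derivative_elimPoly_ne_zero hS hr hS0 hr0 (ε := 1) (by simpa using h) ?_ ?_
  · intro ε hε h'
    set κ : ℤ := Fintype.card V - 2
    have hκ0 : (κ : L) ≠ 0 := by
      rw [Int.cast_ne_zero]; omega
    rw [← hκ] at h h'
    have hεr : ∀ y, r y = ((if ε y = -1 then 1 else 0 : ℤ) : L) * r y +
        ((if ε y = -1 then 0 else 1 : ℤ) : L) * r y := fun y => by split_ifs <;> simp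
    have hεr' : ∀ y, ((ε y : ℤ) : L) * r y = ((if ε y = -1 then 0 else 1 : ℤ) : L) * r y -
        ((if ε y = -1 then 1 else 0 : ℤ) : L) * r y := fun y => by
      rcases Int.units_eq_one_or (ε y) with hy | hy <;> simp [hy]
    rw [Finset.sum_congr rfl fun y _ => hεr y, Finset.sum_add_distrib] at h
    rw [Finset.sum_congr rfl fun y _ => hεr' y, Finset.sum_sub_distrib] at h'
    have hA := fun x => derivation_sqrt_relation hS hr hS0 hr0 (D x) (hD x) 0
      (fun y => if ε y = -1 then 1 else 0) (by push_cast at h h' ⊢; linear_combination (h - h') / 2)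
    have hB := fun x => derivation_sqrt_relation hS hr hS0 hr0 (D x) (hD x) κ
      (fun y => if ε y = -1 then 0 else 1) (by linear_combination (h + h') / 2)
    obtain ⟨x, hx⟩ : ∃ x, ε x = -1 := by
      by_contra! hcon
      exact hε (funext fun x => (Int.units_eq_one_or (ε x)).resolve_right (hcon x))
    by_cases hall : ∀ y, ε y = -1
    · simp only [hall, if_true, Int.cast_zero, zero_mul, Finset.sum_const_zero] at h h'
      refine mul_ne_zero hκ0 hS0 ?_
      linear_combination (h + h') / 2
    · push Not at hall
      obtain ⟨y, hy⟩ := hall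
      have h1 := hA x
      have h2 := hA y
      have h3 := hB y
      simp only [hx, if_true] at h1
      simp only [hy, if_false] at h2 h3
      have h4 : D y s = 0 := by
        rw [Int.cast_zero, mul_zero, zero_div, zero_div, zero_add] at h2
        refine (mul_eq_zero.mp h2).resolve_right fun h0 => ?_
        rw [h0, Int.cast_zero, zero_div, add_zero, mul_zero] at h1
        exact div_ne_zero (by simp) (hr0 x) h1.symm
      rw [h4, zero_mul] at h3
      exact div_ne_zero (by simp) (hr0 y) h3.symm
  · intro h0
    obtain ⟨x⟩ := ‹Nonempty V›
    have := derivation_sqrt_relation hS hr hS0 hr0 (D x) (hD x) (Fintype.card V - 2)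
      (fun _ => 1) (by rw [hκ]; simpa using h)
    rw [hκ] at this
    simp only [Pi.one_apply, Units.val_one] at h0
    rw [h0, mul_zero] at this
    exact div_ne_zero (by simp) (hr0 x) this.symm

end Derivative

/-! ### Properties of generic points -/

section Generic

/-- A property of points of affine space that holds outside the zero set of some nonzero
polynomial. -/
def Generically {ι : Type} (P : (ι → ℂ) → Prop) : Prop :=
  ∃ f : MvPolynomial ι ℂ, f ≠ 0 ∧ ∀ u : ι → ℂ, MvPolynomial.eval u f ≠ 0 → P u

theorem Generically.mono {ι : Type} {P Q : (ι → ℂ) → Prop} (h : Generically P)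
    (hPQ : ∀ u, P u → Q u) : Generically Q := by
  obtain ⟨f, hf, h⟩ := h
  exact ⟨f, hf, fun u hu => hPQ u (h u hu)⟩

theorem Generically.and {ι : Type} {P Q : (ι → ℂ) → Prop} (hP : Generically P)
    (hQ : Generically Q) : Generically (fun u => P u ∧ Q u) := by
  obtain ⟨f, hf, hP⟩ := hP
  obtain ⟨g, hg, hQ⟩ := hQ
  refine ⟨f * g, mul_ne_zero hf hg, fun u hu => ?_⟩
  rw [map_mul] at hu
  exact ⟨hP u (left_ne_zero_of_mul hu), hQ u (right_ne_zero_of_mul hu)⟩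

theorem Generically.forall {ι κ : Type} [Fintype κ] {P : κ → (ι → ℂ) → Prop}
    (hP : ∀ k, Generically (P k)) : Generically (fun u => ∀ k, P k u) := by
  choose f hf hP using hP
  refine ⟨∏ k, f k, Finset.prod_ne_zero_iff.mpr fun k _ => hf k, fun u hu k => hP k u ?_⟩
  rw [map_prod] at hu
  exact Finset.prod_ne_zero_iff.mp hu k (Finset.mem_univ k)

theorem generically_of_forall {ι : Type} {P : (ι → ℂ) → Prop} (h : ∀ u, P u) : Generically P :=
  ⟨1, one_ne_zero, fun u _ => h u⟩

theorem generically_eval_ne_zero {ι : Type} (f : MvPolynomial ι ℂ) (u₀ : ι → ℂ)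
    (h : MvPolynomial.eval u₀ f ≠ 0) : Generically (fun u => MvPolynomial.eval u f ≠ 0) :=
  ⟨f, fun hf => h (by rw [hf, map_zero]), fun _ hu => hu⟩

/-- Genericity can be pulled back along surjective linear maps. -/
theorem Generically.comp_linearMap {ι κ : Type} [Fintype κ] [DecidableEq κ]
    {P : (ι → ℂ) → Prop} (hP : Generically P) (T : (κ → ℂ) →ₗ[ℂ] (ι → ℂ))
    (hT : Function.Surjective T) : Generically (fun u => P (T u)) := by
  obtain ⟨f, hf, hP⟩ := hP
  have key : ∀ u, MvPolynomial.eval u (MvPolynomial.bind₁ (fun i => ∑ j,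
      MvPolynomial.C (T (Pi.single j 1) i) * MvPolynomial.X j) f) = MvPolynomial.eval (T u) f := by
    intro u
    rw [← MvPolynomial.coe_aeval_eq_eval, ← MvPolynomial.coe_aeval_eq_eval]
    simp only [RingHom.coe_coe]
    rw [MvPolynomial.aeval_bind₁]
    congr 2
    ext1 i
    simp only [map_sum, map_mul, MvPolynomial.aeval_X, MvPolynomial.algHom_C]
    conv_rhs => rw [← Finset.univ_sum_single u, map_sum, Finset.sum_apply]
    refine Finset.sum_congr rfl fun j _ => ?_
    have : (Pi.single j (u j) : κ → ℂ) = u j • Pi.single j 1 := by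
      rw [← Pi.single_smul, smul_eq_mul, mul_one]
    rw [this, map_smul, Pi.smul_apply, smul_eq_mul, mul_comm]
    rfl
  refine ⟨_, fun h0 => hf (MvPolynomial.funext fun v => ?_), fun u hu => hP _ (by rwa [key] at hu)⟩
  obtain ⟨u, rfl⟩ := hT v
  rw [← key, h0, map_zero, map_zero]

/-- A nonzero linear form does not vanish generically. -/
theorem generically_linearMap_ne_zero {κ : Type} [Fintype κ] [DecidableEq κ]
    (T : (κ → ℂ) →ₗ[ℂ] ℂ) (u₀ : κ → ℂ) (h : T u₀ ≠ 0) : Generically (fun u => T u ≠ 0) := by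
  have h1 : Generically (fun v : Unit → ℂ => v () ≠ 0) :=
    (generically_eval_ne_zero (MvPolynomial.X ()) 1 (by simp)).mono fun u hu => by simpa using hu
  refine h1.comp_linearMap (LinearMap.pi fun _ => T) fun v => ⟨(v () / T u₀) • u₀, ?_⟩
  ext
  simp [h]

end Generic

/-! ### Separability of the elimination polynomial for generic degrees -/

section Separable

variable {V : Type} [Fintype V] [DecidableEq V] [Nonempty V]

theorem aeval_elimPoly_X {B : Type} [CommRing B] [Algebra ℂ B] (c : V → B) :
    (elimPoly (MvPolynomial.X : V → MvPolynomial V ℂ)).map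
      (MvPolynomial.aeval c : MvPolynomial V ℂ →ₐ[ℂ] B).toRingHom = elimPoly c := by
  rw [map_elimPoly]
  simp

theorem eval_eval_elimPoly_X (c : V → ℂ) (s : MvPolynomial V ℂ) :
    MvPolynomial.eval c ((elimPoly (MvPolynomial.X : V → MvPolynomial V ℂ)).eval s) =
      (elimPoly c).eval (MvPolynomial.eval c s) := by
  rw [← aeval_elimPoly_X c, Polynomial.eval_map]
  exact Polynomial.hom_eval₂ _ (RingHom.id _) (MvPolynomial.eval c) s

/-- For row sums concentrated at one vertex, every factor at `s = 0` is `1` or `-1`. -/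
theorem elimPoly_eval_zero_ne_zero : ∃ c : V → ℂ, (elimPoly c).eval 0 ≠ 0 := by
  obtain ⟨x⟩ := ‹Nonempty V›
  refine ⟨Pi.single x (-1 / 4), ?_⟩
  rw [eval_elimPoly (S := 0) (r := Pi.single x 1) (by simp) (fun y => by
    by_cases hy : y = x
    · subst hy; norm_num
    · simp [hy])]
  refine Finset.prod_ne_zero_iff.mpr fun ε _ => ?_
  rw [Finset.sum_eq_single x (fun y _ hy => by simp [hy]) (by simp)]
  simp

/-- For constant row sums `1`, all square roots vanish at `s = 4`, and every factor is
`(n - 2) * 2`. -/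
theorem elimPoly_eval_four_ne_zero (hV : 3 ≤ Fintype.card V) :
    (elimPoly (1 : V → ℂ)).eval 4 ≠ 0 := by
  rw [eval_elimPoly (S := 2) (r := 0) (by norm_num) (fun y => by simp)]
  refine Finset.prod_ne_zero_iff.mpr fun ε _ => ?_
  have : (Fintype.card V : ℂ) - 2 ≠ 0 := by
    rw [sub_ne_zero]
    exact_mod_cast (by omega : Fintype.card V ≠ 2)
  simpa using this

omit [Fintype V] [Nonempty V] in
/-- The partial derivatives of the polynomial ring extend to every formally étale algebra over
it, in particular to the algebraic closure of its fraction field. -/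
theorem exists_derivation_of_formallyEtale (L : Type) [Field L] [Algebra ℂ L]
    [Algebra (MvPolynomial V ℂ) L] [IsScalarTower ℂ (MvPolynomial V ℂ) L]
    [Algebra.FormallyEtale (MvPolynomial V ℂ) L] (x : V) :
    ∃ D : Derivation ℂ L L,
      ∀ y, D (algebraMap (MvPolynomial V ℂ) L (MvPolynomial.X y)) = if y = x then 1 else 0 := by
  let D₀ : Derivation ℂ (MvPolynomial V ℂ) L := MvPolynomial.mkDerivation ℂ (Pi.single x 1)
  let f : KaehlerDifferential ℂ L →ₗ[L] L :=
    (LinearMap.liftBaseChange L D₀.liftKaehlerDifferential) ∘ₗ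
      (KaehlerDifferential.tensorKaehlerEquivOfFormallyEtale ℂ (MvPolynomial V ℂ) L).symm.toLinearMap
  refine ⟨f.compDer (KaehlerDifferential.D ℂ L), fun y => ?_⟩
  change LinearMap.liftBaseChange L D₀.liftKaehlerDifferential
    ((KaehlerDifferential.tensorKaehlerEquivOfFormallyEtale ℂ (MvPolynomial V ℂ) L).symm
      (KaehlerDifferential.D ℂ L (algebraMap (MvPolynomial V ℂ) L (MvPolynomial.X y)))) = _
  rw [KaehlerDifferential.tensorKaehlerEquivOfFormallyEtale_symm_D_algebraMap]
  simp [D₀, MvPolynomial.mkDerivation_X, Pi.single_apply]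

/-- A Bézout identity over the polynomial ring, with a nonzero constant. -/
theorem exists_bezout_of_isCoprime_map {A K : Type} [CommRing A] [IsDomain A] [Field K]
    [Algebra A K] [IsFractionRing A K] {p q : Polynomial A}
    (h : IsCoprime (p.map (algebraMap A K)) (q.map (algebraMap A K))) :
    ∃ a b : Polynomial A, ∃ g : A, g ≠ 0 ∧ a * p + b * q = Polynomial.C g := by
  obtain ⟨a, b, hab⟩ := h
  obtain ⟨m, hm, ha⟩ := IsLocalization.integerNormalization_spec (nonZeroDivisors A) a
  obtain ⟨l, hl, hb⟩ := IsLocalization.integerNormalization_spec (nonZeroDivisors A) b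
  refine ⟨Polynomial.C l * IsLocalization.integerNormalization (nonZeroDivisors A) a,
    Polynomial.C m * IsLocalization.integerNormalization (nonZeroDivisors A) b, m * l,
    mul_ne_zero (nonZeroDivisors.ne_zero hm) (nonZeroDivisors.ne_zero hl), ?_⟩
  apply Polynomial.map_injective _ (IsFractionRing.injective A K)
  simp only [Polynomial.map_add, Polynomial.map_mul, Polynomial.map_C, ha, hb, map_mul,
    Algebra.smul_def, Polynomial.algebraMap_apply]
  linear_combination Polynomial.C (algebraMap A K m) * Polynomial.C (algebraMap A K l) * hab

/-- Over the fraction field of the ring of polynomials in the degrees, the elimination polynomial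
is separable. -/
theorem isCoprime_elimPoly_X (hV : 3 ≤ Fintype.card V) (K L : Type) [Field K] [Field L]
    [Algebra (MvPolynomial V ℂ) K] [IsFractionRing (MvPolynomial V ℂ) K] [Algebra K L]
    [Algebra (MvPolynomial V ℂ) L] [IsScalarTower (MvPolynomial V ℂ) K L] [Algebra ℂ L]
    [IsScalarTower ℂ (MvPolynomial V ℂ) L] [IsAlgClosed L] [Algebra.IsSeparable K L]
    (h0 : (elimPoly (MvPolynomial.X : V → MvPolynomial V ℂ)).eval 0 ≠ 0)
    (h4 : ∀ x, (elimPoly (MvPolynomial.X : V → MvPolynomial V ℂ)).eval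
      (4 * MvPolynomial.X x) ≠ 0) :
    IsCoprime ((elimPoly (MvPolynomial.X : V → MvPolynomial V ℂ)).map (algebraMap _ K))
      ((elimPoly (MvPolynomial.X : V → MvPolynomial V ℂ)).derivative.map (algebraMap _ K)) := by
  have h1 : Algebra.FormallyEtale (MvPolynomial V ℂ) K :=
    Algebra.FormallyEtale.of_isLocalization (nonZeroDivisors (MvPolynomial V ℂ))
  have h2 : Algebra.FormallyEtale K L := Algebra.FormallyEtale.of_isSeparable K L
  have h3 : Algebra.FormallyEtale (MvPolynomial V ℂ) L :=
    Algebra.FormallyEtale.comp (MvPolynomial V ℂ) K L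
  have hinj : Function.Injective (algebraMap (MvPolynomial V ℂ) L) := by
    rw [IsScalarTower.algebraMap_eq (MvPolynomial V ℂ) K L]
    exact (algebraMap K L).injective.comp (IsFractionRing.injective _ K)
  set p : Polynomial (MvPolynomial V ℂ) := elimPoly MvPolynomial.X
  set c : V → L := fun x => algebraMap (MvPolynomial V ℂ) L (MvPolynomial.X x)
  have hp : p.map (algebraMap (MvPolynomial V ℂ) L) = elimPoly c :=
    map_elimPoly (IsScalarTower.toAlgHom ℂ (MvPolynomial V ℂ) L) MvPolynomial.X
  have hev : ∀ a, (elimPoly c).eval (algebraMap (MvPolynomial V ℂ) L a) =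
      algebraMap (MvPolynomial V ℂ) L (p.eval a) := by
    intro a
    rw [← hp, Polynomial.eval_map, Polynomial.eval₂_at_apply]
  choose D hD using exists_derivation_of_formallyEtale (V := V) L
  refine (Polynomial.isCoprime_iff_aeval_ne_zero_of_isAlgClosed (k := K) L _ _).mpr fun s => ?_
  by_contra! hcon
  obtain ⟨hs, hs'⟩ := hcon
  rw [Polynomial.aeval_map_algebraMap, Polynomial.aeval_def, ← Polynomial.eval_map] at hs hs'
  rw [← Polynomial.derivative_map, hp] at hs'
  rw [hp] at hs
  refine derivative_elimPoly_ne_zero_of_derivation hV D hD ?_ ?_ hs hs'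
  · rintro rfl
    have := hev 0
    rw [map_zero, hs, eq_comm, map_eq_zero_iff _ hinj] at this
    exact h0 this
  · rintro x rfl
    have := hev (4 * MvPolynomial.X x)
    rw [map_mul, map_ofNat, hs, eq_comm, map_eq_zero_iff _ hinj] at this
    exact h4 x this

/-- For generic degrees the elimination polynomial has simple roots only, none of which makes one
of the square roots vanish. -/
theorem generically_elimPoly (hV : 3 ≤ Fintype.card V) :
    Generically (fun c : V → ℂ => (elimPoly c).Separable ∧ (elimPoly c).eval 0 ≠ 0 ∧
      ∀ x, (elimPoly c).eval (4 * c x) ≠ 0) := by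
  set p : Polynomial (MvPolynomial V ℂ) := elimPoly MvPolynomial.X
  obtain ⟨c₀, hc₀⟩ := elimPoly_eval_zero_ne_zero (V := V)
  have h0 : p.eval 0 ≠ 0 := fun h => hc₀ (by
    have := eval_eval_elimPoly_X c₀ 0
    rwa [h, map_zero, eq_comm] at this)
  have h4 : ∀ x, p.eval (4 * MvPolynomial.X x) ≠ 0 := fun x h => elimPoly_eval_four_ne_zero hV (by
    have := eval_eval_elimPoly_X 1 (4 * MvPolynomial.X x)
    rw [h, map_zero, eq_comm] at this
    simpa using this)
  obtain ⟨a, b, g, hg, hab⟩ := exists_bezout_of_isCoprime_map (isCoprime_elimPoly_X hV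
    (FractionRing (MvPolynomial V ℂ)) (AlgebraicClosure (FractionRing (MvPolynomial V ℂ))) h0 h4)
  refine ((show Generically (fun c : V → ℂ => (elimPoly c).Separable) from ⟨g, hg, ?_⟩).and
    ((show Generically (fun c : V → ℂ => (elimPoly c).eval 0 ≠ 0) from ⟨_, h0, ?_⟩).and
      (Generically.forall fun x => ⟨_, h4 x, ?_⟩)))
  · intro c hc
    have := congrArg (Polynomial.map (MvPolynomial.eval c)) hab
    rw [Polynomial.map_add, Polynomial.map_mul, Polynomial.map_mul, ← Polynomial.derivative_map,
      Polynomial.map_C, show p.map (MvPolynomial.eval c) = elimPoly c from aeval_elimPoly_X c] at this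
    refine ⟨Polynomial.C (MvPolynomial.eval c g)⁻¹ * a.map (MvPolynomial.eval c),
      Polynomial.C (MvPolynomial.eval c g)⁻¹ * b.map (MvPolynomial.eval c), ?_⟩
    rw [mul_assoc, mul_assoc, ← mul_add, this, ← Polynomial.C_mul, inv_mul_cancel₀ hc,
      Polynomial.C_1]
  · intro c hc
    rwa [eval_eval_elimPoly_X, map_zero] at hc
  · intro c hc
    rwa [eval_eval_elimPoly_X, map_mul, map_ofNat, MvPolynomial.eval_X] at hc

end Separable

/-! ### The degree of the elimination polynomial -/

section Degree

variable {V : Type} [Fintype V] [DecidableEq V]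

/-- The power series `√(1 - 4 a X)` with constant term `1`. -/
noncomputable def sqrtSeries (a : ℂ) : PowerSeries ℂ :=
  PowerSeries.rescale (-4 * a) (PowerSeries.binomialSeries ℂ (1 / 2 : ℚ))

theorem sqrtSeries_sq (a : ℂ) :
    sqrtSeries a ^ 2 = 1 - PowerSeries.C (4 * a) * PowerSeries.X := by
  rw [sqrtSeries, ← map_pow, pow_two, ← PowerSeries.binomialSeries_add]
  have : (1 / 2 + 1 / 2 : ℚ) = ((1 : ℕ) : ℚ) := by norm_num
  rw [this, PowerSeries.binomialSeries_nat, pow_one, map_add, map_one, PowerSeries.rescale_X]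
  simp [sub_eq_add_neg]

theorem constantCoeff_sqrtSeries (a : ℂ) : PowerSeries.coeff 0 (sqrtSeries a) = 1 := by
  simp [sqrtSeries, PowerSeries.coeff_rescale]

theorem coeff_one_sqrtSeries (a : ℂ) : PowerSeries.coeff 1 (sqrtSeries a) = -2 * a := by
  simp [sqrtSeries, PowerSeries.coeff_rescale, Algebra.smul_def]
  ring

/-- The choice of signs with a single plus sign, at `x`. -/
def singlePlus (x : V) : V → ℤˣ := fun y => if y = x then 1 else -1

theorem sum_sign_eq_iff (ε : V → ℤˣ) :
    ((Fintype.card V : ℂ) - 2 + ∑ x, ((ε x : ℤ) : ℂ) = 0) ↔ ∃ x, ε = singlePlus x := by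
  have h : (∑ x, ((ε x : ℤ) : ℂ)) = 2 * (Finset.univ.filter fun x => ε x = 1).card
      - Fintype.card V := by
    have : ∀ x, ((ε x : ℤ) : ℂ) = 2 * (if ε x = 1 then 1 else 0) - 1 := fun x => by
      rcases Int.units_eq_one_or (ε x) with hx | hx <;> simp [hx]
      norm_num
    simp_rw [this, Finset.sum_sub_distrib, ← Finset.mul_sum]
    simp
  rw [h]
  have h2 : ((Fintype.card V : ℂ) - 2 + (2 * (Finset.univ.filter fun x => ε x = 1).card
      - Fintype.card V) = 0) ↔ (Finset.univ.filter fun x => ε x = 1).card = 1 := by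
    rw [← Nat.cast_inj (R := ℂ)]
    constructor
    · intro h; push_cast; linear_combination h / 2
    · intro h; push_cast at h; linear_combination 2 * h
  rw [h2, Finset.card_eq_one]
  refine exists_congr fun x => ⟨fun h => funext fun y => ?_, ?_⟩
  · have := Finset.ext_iff.mp h y
    simp only [Finset.mem_filter, Finset.mem_univ, true_and, Finset.mem_singleton] at this
    unfold singlePlus
    split_ifs with hy
    · exact this.mpr hy
    · exact (Int.units_eq_one_or _).resolve_left (fun h => hy (this.mp h))
  · rintro rfl
    ext y
    simp [singlePlus]

omit [Fintype V] in
theorem singlePlus_injective : Function.Injective (singlePlus : V → V → ℤˣ) := by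
  intro x y h
  have := congrFun h x
  by_contra hxy
  simp [singlePlus, hxy] at this

/-- Exactly one factor per vertex vanishes at the origin, to first order. -/
theorem order_signProd_sqrtSeries {c : V → ℂ} (hc : ∀ x, ∑ y, c y ≠ 2 * c x) :
    (signProd ((Fintype.card V : PowerSeries ℂ) - 2) (fun x => sqrtSeries (c x))).order =
      Fintype.card V := by
  have hz : ∀ z : ℤ, (z : PowerSeries ℂ) = PowerSeries.C (z : ℂ) := fun z => (map_intCast _ z).symm
  have hn : (Fintype.card V : PowerSeries ℂ) - 2 = PowerSeries.C ((Fintype.card V : ℂ) - 2) := by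
    rw [map_sub, map_natCast, map_ofNat]
  have hfac : ∀ ε : V → ℤˣ, ((Fintype.card V : PowerSeries ℂ) - 2 +
      ∑ x, ((ε x : ℤ) : PowerSeries ℂ) * sqrtSeries (c x)).order =
      if ∃ x, ε = singlePlus x then 1 else 0 := by
    intro ε
    rw [hn]
    simp_rw [hz]
    have h0 : PowerSeries.coeff 0 (PowerSeries.C ((Fintype.card V : ℂ) - 2) +
        ∑ x, PowerSeries.C ((ε x : ℤ) : ℂ) * sqrtSeries (c x)) =
        (Fintype.card V : ℂ) - 2 + ∑ x, ((ε x : ℤ) : ℂ) := by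
      simp only [map_add, map_sum, PowerSeries.coeff_C_mul, constantCoeff_sqrtSeries, mul_one]
      simp
    split_ifs with h
    · have h1 := h0
      rw [(sum_sign_eq_iff ε).mpr h] at h1
      obtain ⟨x, rfl⟩ := h
      refine PowerSeries.order_eq_nat.mpr ⟨?_, fun i hi => ?_⟩
      · simp only [map_add, map_sum, PowerSeries.coeff_C_mul, coeff_one_sqrtSeries]
        rw [PowerSeries.coeff_C, if_neg one_ne_zero, zero_add]
        have : ∀ y, (((singlePlus x y : ℤˣ) : ℤ) : ℂ) * (-2 * c y) =
            2 * c y - if y = x then 4 * c y else 0 := fun y => by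
          unfold singlePlus
          split_ifs <;> simp
          ring
        simp_rw [this, Finset.sum_sub_distrib, ← Finset.mul_sum]
        simp only [Finset.sum_ite_eq', Finset.mem_univ, if_true]
        intro h
        exact hc x (by linear_combination h / 2)
      · obtain rfl : i = 0 := by omega
        exact h1
    · refine PowerSeries.order_eq_nat.mpr ⟨?_, fun i hi => by omega⟩
      rw [h0]
      exact fun h' => h ((sum_sign_eq_iff ε).mp h')
  rw [signProd, PowerSeries.order_prod]
  simp_rw [hfac]
  rw [Finset.sum_ite, Finset.sum_const_zero, add_zero, Finset.sum_const, nsmul_one]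
  have : (Finset.univ.filter fun ε : V → ℤˣ => ∃ x, ε = singlePlus x) =
      Finset.univ.image singlePlus := by
    ext ε; simp [eq_comm]
  rw [this, Finset.card_image_of_injective _ singlePlus_injective, Finset.card_univ]

variable [Nonempty V]

/-- The elimination polynomial in the reciprocal unknown. -/
noncomputable def recipPoly (c : V → ℂ) : Polynomial ℂ :=
  MvPolynomial.aeval (fun o => o.elim (((Fintype.card V : Polynomial ℂ) - 2) ^ 2)
    fun x => 1 - Polynomial.C (4 * c x) * Polynomial.X) (signNorm V)

/-- Homogeneity: dividing all square roots by `√s` passes to the reciprocal variable. -/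
theorem eval_elimPoly_eq (c : V → ℂ) {s : ℂ} (hs : s ≠ 0) :
    (elimPoly c).eval s = s ^ 2 ^ (Fintype.card V - 1) * (recipPoly c).eval s⁻¹ := by
  obtain ⟨S, hS⟩ := IsAlgClosed.exists_pow_nat_eq s (n := 2) two_pos
  have hS0 : S ≠ 0 := by rintro rfl; exact hs (by simpa using hS.symm)
  choose r hr using fun x => IsAlgClosed.exists_pow_nat_eq (s - 4 * c x) (n := 2) two_pos
  have h1 : (recipPoly c).eval s⁻¹ = signProd ((Fintype.card V : ℂ) - 2) (fun x => r x / S) := by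
    rw [← aeval_signNorm, recipPoly]
    have := MvPolynomial.map_aeval (fun o : Option V =>
      o.elim (((Fintype.card V : Polynomial ℂ) - 2) ^ 2)
      fun x => 1 - Polynomial.C (4 * c x) * Polynomial.X)
      (Polynomial.evalRingHom s⁻¹) (signNorm V)
    rw [← Polynomial.coe_evalRingHom, this, MvPolynomial.aeval_def, MvPolynomial.coe_eval₂Hom]
    congr 1
    · ext a : 1
      simp
    · ext1 o
      cases o
      · simp
      · simp [div_pow, hr, hS]
        field_simp
  rw [eval_elimPoly hS hr, h1, ← hS, ← pow_mul, ← pow_succ',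
    Nat.sub_add_cancel Fintype.card_pos, ← signProd_mul]
  congr 1
  · ring
  · ext x; field_simp

theorem coe_recipPoly (c : V → ℂ) : (recipPoly c : PowerSeries ℂ) =
    signProd ((Fintype.card V : PowerSeries ℂ) - 2) (fun x => sqrtSeries (c x)) := by
  rw [← aeval_signNorm, recipPoly]
  have := MvPolynomial.map_aeval (fun o : Option V =>
      o.elim (((Fintype.card V : Polynomial ℂ) - 2) ^ 2)
      fun x => 1 - Polynomial.C (4 * c x) * Polynomial.X)
      (Polynomial.coeToPowerSeries.ringHom (R := ℂ)) (signNorm V)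
  rw [← Polynomial.coeToPowerSeries.ringHom_apply, this, MvPolynomial.aeval_def,
    MvPolynomial.coe_eval₂Hom]
  congr 1
  · ext a : 1
    simp
  · ext1 o
    cases o
    · have h2 : ((2 : Polynomial ℂ) : PowerSeries ℂ) = 2 :=
        map_ofNat (Polynomial.coeToPowerSeries.ringHom (R := ℂ)) 2
      have hn : ((Fintype.card V : Polynomial ℂ) : PowerSeries ℂ) = Fintype.card V :=
        map_natCast (Polynomial.coeToPowerSeries.ringHom (R := ℂ)) _
      simp [h2, hn]
    · simp [sqrtSeries_sq]

theorem natTrailingDegree_recipPoly {c : V → ℂ} (hc : ∀ x, ∑ y, c y ≠ 2 * c x) :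
    recipPoly c ≠ 0 ∧ (recipPoly c).natTrailingDegree = Fintype.card V := by
  have h := order_signProd_sqrtSeries hc
  rw [← coe_recipPoly, PowerSeries.order_eq_nat] at h
  simp only [Polynomial.coeff_coe] at h
  have h0 : recipPoly c ≠ 0 := fun h0 => h.1 (by rw [h0, Polynomial.coeff_zero])
  refine ⟨h0, le_antisymm (Polynomial.natTrailingDegree_le_of_ne_zero h.1) ?_⟩
  exact Polynomial.le_natTrailingDegree h0 h.2

/-- The degree of the elimination polynomial: of the `2 ^ (n - 1)` expected roots, `n` are lost
at infinity. -/
theorem natDegree_elimPoly {c : V → ℂ} (hc : ∀ x, ∑ y, c y ≠ 2 * c x) :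
    (elimPoly c).natDegree = 2 ^ (Fintype.card V - 1) - Fintype.card V := by
  obtain ⟨h0, hn⟩ := natTrailingDegree_recipPoly hc
  set Q := recipPoly c
  -- both sides agree at all nonzero points, and the trailing degree of `Q` is known
  have hid : Polynomial.X ^ Q.natDegree * elimPoly c =
      Polynomial.X ^ 2 ^ (Fintype.card V - 1) * Q.reverse := by
    refine Polynomial.eq_of_infinite_eval_eq _ _ ((Set.finite_singleton (0 : ℂ)).infinite_compl.mono
      fun s hs => ?_)
    have hs : s ≠ 0 := hs
    have := invertibleOfNonzero (inv_ne_zero hs)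
    have h := Polynomial.eval₂_reverse_mul_pow (RingHom.id ℂ) s⁻¹ Q
    rw [invOf_eq_inv, inv_inv] at h
    simp only [Set.mem_ofPred_eq, Polynomial.eval_mul, Polynomial.eval_pow, Polynomial.eval_X]
    rw [eval_elimPoly_eq c hs, Polynomial.eval, Polynomial.eval, ← h, inv_pow]
    field_simp
  have hr0 : Q.reverse ≠ 0 := by simpa using h0
  have hp0 : elimPoly c ≠ 0 := by
    intro hp
    rw [hp, mul_zero] at hid
    exact mul_ne_zero (pow_ne_zero _ Polynomial.X_ne_zero) hr0 hid.symm
  have hdeg := congrArg Polynomial.natDegree hid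
  rw [Polynomial.natDegree_X_pow_mul _ hp0, Polynomial.natDegree_X_pow_mul _ hr0,
    Polynomial.reverse_natDegree, hn] at hdeg
  have := hn ▸ Polynomial.natTrailingDegree_le_natDegree Q
  omega

end Degree

/-! ### One block: symmetric rank-one tables with given row sums -/

section OneBlock

variable {V : Type} [Fintype V]

/-- The solutions of the likelihood equations of a single block with vertex set `V` and row sums
`c`, as symmetric tables with zero diagonal. -/
def blockSolutions (c : V → ℂ) : Set (V → V → ℂ) :=
  {q | (∀ x y, q x y = q y x) ∧ (∀ x, q x x = 0) ∧ (∀ x, ∑ y, q x y = c x) ∧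
    ∀ t u v w, t ≠ u → t ≠ v → t ≠ w → u ≠ v → u ≠ w → v ≠ w →
      q t u * q v w = q t v * q u w}

/-- A zero entry would force the nonzero entries to form a star, whose centre has row sum equal
to the sum of the other row sums. -/
theorem blockSolutions_ne_zero {c : V → ℂ} (h0 : ∀ x, c x ≠ 0)
    (hc : ∀ x, ∑ y, c y ≠ 2 * c x) {q : V → V → ℂ} (hq : q ∈ blockSolutions c) {x y : V}
    (hxy : x ≠ y) : q x y ≠ 0 := by
  classical
  obtain ⟨hsymm, hdiag, hsum, hquad⟩ := hq
  intro hz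
  have hnb : ∀ a, ∃ b, q a b ≠ 0 := by
    intro a
    by_contra! hcon
    exact h0 a (by rw [← hsum a]; exact Finset.sum_eq_zero fun b _ => hcon b)
  have hne : ∀ {a b}, q a b ≠ 0 → a ≠ b := fun h hab => h (by rw [hab]; exact hdiag _)
  -- the neighbours of two non-adjacent vertices coincide
  have hsame : ∀ {a b d e}, a ≠ b → q a b = 0 → q a d ≠ 0 → q b e ≠ 0 → d = e := by
    intro a b d e hab hab0 had hbe
    by_contra hde
    have h1 : d ≠ b := fun h => had (h ▸ hab0)
    have h2 : e ≠ a := fun h => hbe (by rw [h, hsymm]; exact hab0)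
    have := hquad a d b e (hne had) hab h2.symm h1 hde (hne hbe)
    rw [hab0, zero_mul] at this
    exact mul_ne_zero had hbe this
  obtain ⟨z, hz1⟩ := hnb x
  obtain ⟨z', hz2⟩ := hnb y
  obtain rfl := hsame hxy hz hz1 hz2
  have hx : ∀ d, d ≠ z → q x d = 0 := by
    intro d hd
    by_contra h
    exact hd (hsame hxy hz h hz2)
  have hstar : ∀ a b, a ≠ z → b ≠ z → q a b = 0 := by
    intro a b ha hb
    by_cases hax : a = x
    · rw [hax]; exact hx b hb
    · by_contra h
      exact hb (hsame (Ne.symm hax) (hx a ha) hz1 h).symm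
  have hrow : ∀ a, a ≠ z → c a = q z a := by
    intro a ha
    rw [← hsum a, Finset.sum_eq_single z (fun b _ hb => hstar a b ha hb) (by simp), hsymm]
  refine hc z ?_
  rw [← Finset.add_sum_erase _ _ (Finset.mem_univ z),
    Finset.sum_congr rfl fun a ha => hrow a (Finset.ne_of_mem_erase ha)]
  have := hsum z
  rw [← Finset.add_sum_erase _ _ (Finset.mem_univ z), hdiag, zero_add] at this
  rw [this]; ring

/-- A symmetric table without zeros that satisfies the quadratic equations has rank one off the
diagonal. -/
theorem blockSolutions_exists_eq_mul (hV : 3 ≤ Fintype.card V) {c : V → ℂ} {q : V → V → ℂ}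
    (hq : q ∈ blockSolutions c) (hne : ∀ x y, x ≠ y → q x y ≠ 0) :
    ∃ θ : V → ℂ, ∀ x y, x ≠ y → q x y = θ x * θ y := by
  classical
  obtain ⟨hsymm, -, -, hquad⟩ := hq
  obtain ⟨a, b, d, hab, had, hbd⟩ := Fintype.two_lt_card_iff.mp hV
  obtain ⟨τ, hτ⟩ := IsAlgClosed.exists_pow_nat_eq (q a b * q a d / q b d) (n := 2) two_pos
  have nab := hne a b hab
  have nad := hne a d had
  have nbd := hne b d hbd
  have hτ0 : τ ≠ 0 := by
    rintro rfl
    rw [zero_pow two_ne_zero] at hτ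
    exact div_ne_zero (mul_ne_zero nab nad) nbd hτ.symm
  refine ⟨fun x => if x = a then τ else q a x / τ, ?_⟩
  have key : ∀ x y, x ≠ a → y ≠ a → x ≠ y → q x y * (q a b * q a d) = q a x * q a y * q b d := by
    -- the case where `x` is one of the two reference vertices
    have hb : ∀ y, y ≠ a → y ≠ b → q b y * q a d = q a y * q b d := by
      intro y hya hyb
      by_cases hyd : y = d
      · rw [hyd]; ring
      · have := hquad a d y b had hya.symm hab (Ne.symm hyd) hbd.symm hyb
        linear_combination this - q a d * hsymm y b - q a y * hsymm b d
    have hd : ∀ y, y ≠ a → y ≠ d → q d y * q a b = q a y * q b d := by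
      intro y hya hyd
      by_cases hyb : y = b
      · rw [hyb, hsymm d b]; ring
      · have := hquad a b y d hab hya.symm had (Ne.symm hyb) hbd hyd
        linear_combination this - q a b * hsymm y d
    intro x y hxa hya hxy
    by_cases hxb : x = b
    · subst hxb
      linear_combination q a x * hb y hya (Ne.symm hxy)
    by_cases hxd : x = d
    · subst hxd
      linear_combination q a x * hd y hya (Ne.symm hxy)
    by_cases hyd : y = d
    · subst hyd
      linear_combination q a y * hd x hxa hxd + q a b * q a y * hsymm x y
    have h1 := hd x hxa hxd
    have h2 := hquad a d x y had hxa.symm hya.symm (Ne.symm hxd) (Ne.symm hyd) hxy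
    linear_combination q a b * h2 + q a x * hd y hya hyd
  intro x y hxy
  simp only
  by_cases hx : x = a
  · subst hx
    rw [if_pos rfl, if_neg (Ne.symm hxy)]
    field_simp
  by_cases hy : y = a
  · subst hy
    rw [if_pos rfl, if_neg hx, hsymm]
    field_simp
  · have h := key x y hx hy hxy
    rw [if_neg hx, if_neg hy, div_mul_div_comm, ← pow_two, hτ]
    field_simp
    linear_combination h

/-- The table with off-diagonal entries `θ x * θ y`. -/
def rankOne [DecidableEq V] (θ : V → ℂ) : V → V → ℂ := fun x y => if x = y then 0 else θ x * θ y

theorem sum_rankOne [DecidableEq V] (θ : V → ℂ) (x : V) :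
    ∑ y, rankOne θ x y = θ x * (∑ y, θ y - θ x) := by
  have : ∀ y, rankOne θ x y = θ x * θ y - if x = y then θ x * θ y else 0 := fun y => by
    unfold rankOne; split_ifs <;> simp
  simp_rw [this, Finset.sum_sub_distrib, ← Finset.mul_sum]
  simp
  ring

theorem rankOne_mem [DecidableEq V] {θ c : V → ℂ} (h : ∀ x, θ x * (∑ y, θ y - θ x) = c x) :
    rankOne θ ∈ blockSolutions c := by
  refine ⟨fun x y => ?_, fun x => by simp [rankOne], fun x => by rw [sum_rankOne, h], ?_⟩
  · unfold rankOne
    by_cases hxy : x = y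
    · rw [hxy]
    · rw [if_neg hxy, if_neg (Ne.symm hxy), mul_comm]
  · intro t u v w h1 h2 h3 h4 h5 h6
    simp only [rankOne, h1, h2, h5, h6, if_false]
    ring

theorem blockSolutions_exists_eq_rankOne [DecidableEq V] (hV : 3 ≤ Fintype.card V) {c : V → ℂ}
    (h0 : ∀ x, c x ≠ 0) (hc : ∀ x, ∑ y, c y ≠ 2 * c x) {q : V → V → ℂ}
    (hq : q ∈ blockSolutions c) :
    ∃ θ : V → ℂ, q = rankOne θ ∧ ∀ x, θ x * (∑ y, θ y - θ x) = c x := by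
  obtain ⟨θ, hθ⟩ := blockSolutions_exists_eq_mul hV hq fun x y hxy =>
    blockSolutions_ne_zero h0 hc hq hxy
  have h : q = rankOne θ := by
    funext x y
    unfold rankOne
    split_ifs with hxy
    · rw [hxy]; exact hq.2.1 y
    · exact hθ x y hxy
  refine ⟨θ, h, fun x => ?_⟩
  rw [← sum_rankOne, ← h]
  exact hq.2.2.1 x

/-- A rank-one table without zeros determines its factor up to sign. -/
theorem eq_or_eq_neg_of_rankOne_eq [DecidableEq V] (hV : 3 ≤ Fintype.card V) {θ θ' : V → ℂ}
    (h0 : ∀ x y, x ≠ y → rankOne θ x y ≠ 0) (h : rankOne θ = rankOne θ') :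
    θ' = θ ∨ θ' = -θ := by
  have hmul : ∀ x y, x ≠ y → θ x * θ y = θ' x * θ' y := fun x y hxy => by
    have := congrFun (congrFun h x) y
    simpa [rankOne, hxy] using this
  have h0' : ∀ x y, x ≠ y → θ x * θ y ≠ 0 := fun x y hxy => by
    have := h0 x y hxy
    simpa only [rankOne, if_neg hxy] using this
  obtain ⟨a, b, d, hab, had, hbd⟩ := Fintype.two_lt_card_iff.mp hV
  have ha0 : θ a ≠ 0 := left_ne_zero_of_mul (h0' a b hab)
  have hsq : θ' a ^ 2 = θ a ^ 2 := by
    have h1 := hmul a b hab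
    have h2 := hmul a d had
    have h3 := hmul b d hbd
    have := h0' b d hbd
    refine mul_right_cancel₀ this ?_
    linear_combination θ' a ^ 2 * h3 - θ' a * θ' d * h1 - θ a * θ b * h2
  have hall : ∀ x, θ x * θ a = θ' x * θ' a := fun x => by
    by_cases hx : x = a
    · rw [hx, ← pow_two, ← pow_two, hsq]
    · exact hmul x a hx
  rcases sq_eq_sq_iff_eq_or_eq_neg.mp hsq with ha | ha
  · refine Or.inl (funext fun x => mul_right_cancel₀ ha0 ?_)
    have := hall x
    rw [ha] at this
    exact this.symm
  · refine Or.inr (funext fun x => mul_right_cancel₀ ha0 ?_)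
    have := hall x
    rw [ha] at this
    simp only [Pi.neg_apply]
    linear_combination this

variable [DecidableEq V] [Nonempty V]

/-- With the square roots `2 θ x - S`, the factor with all signs positive vanishes. -/
theorem eval_elimPoly_of_solution {c θ : V → ℂ} (h : ∀ x, θ x * (∑ y, θ y - θ x) = c x) :
    (elimPoly c).eval ((∑ y, θ y) ^ 2) = 0 := by
  rw [eval_elimPoly (S := ∑ y, θ y) (r := fun x => 2 * θ x - ∑ y, θ y) rfl
    (fun x => by rw [← h x]; ring)]
  refine Finset.prod_eq_zero (Finset.mem_univ 1) ?_
  simp only [Pi.one_apply, Units.val_one, Int.cast_one, one_mul, Finset.sum_sub_distrib,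
    ← Finset.mul_sum, Finset.sum_const, Finset.card_univ, nsmul_eq_mul]
  ring

theorem exists_solution_of_eval_elimPoly {c : V → ℂ} {s : ℂ} (h : (elimPoly c).eval s = 0) :
    ∃ θ : V → ℂ, (∀ x, θ x * (∑ y, θ y - θ x) = c x) ∧ (∑ y, θ y) ^ 2 = s := by
  obtain ⟨S, hS⟩ := IsAlgClosed.exists_pow_nat_eq s (n := 2) two_pos
  choose r hr using fun x => IsAlgClosed.exists_pow_nat_eq (s - 4 * c x) (n := 2) two_pos
  rw [eval_elimPoly hS hr, signProd, Finset.prod_eq_zero_iff] at h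
  obtain ⟨ε, -, hε⟩ := h
  have hsum : ∑ x, (S + ((ε x : ℤ) : ℂ) * r x) / 2 = S := by
    rw [← Finset.sum_div, Finset.sum_add_distrib, Finset.sum_const, Finset.card_univ, nsmul_eq_mul]
    linear_combination hε / 2
  refine ⟨fun x => (S + ((ε x : ℤ) : ℂ) * r x) / 2, fun x => ?_, by rw [hsum, hS]⟩
  rw [hsum]
  have h1 : (((ε x : ℤ) : ℂ)) ^ 2 = 1 := by
    rcases Int.units_eq_one_or (ε x) with hx | hx <;> simp [hx]
  linear_combination (hS - hr x) / 4 - r x ^ 2 * h1 / 4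

/-- Over a simple root of the elimination polynomial there is only one solution. -/
theorem eq_or_eq_neg_of_sq_sum_eq {c θ θ' : V → ℂ} (hsep : (elimPoly c).Separable)
    (hz : (elimPoly c).eval 0 ≠ 0) (h4 : ∀ x, (elimPoly c).eval (4 * c x) ≠ 0)
    (h : ∀ x, θ x * (∑ y, θ y - θ x) = c x) (h' : ∀ x, θ' x * (∑ y, θ' y - θ' x) = c x)
    (hs : (∑ y, θ y) ^ 2 = (∑ y, θ' y) ^ 2) : θ' = θ ∨ θ' = -θ := by
  have hroot := eval_elimPoly_of_solution h
  -- the case of equal sums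
  have key : ∀ θ' : V → ℂ, (∀ x, θ' x * (∑ y, θ' y - θ' x) = c x) → ∑ y, θ' y = ∑ y, θ y →
      θ' = θ := by
    intro θ' h' hs
    set S := ∑ y, θ y with hS
    have hS0 : S ≠ 0 := by
      intro h0
      rw [h0, zero_pow two_ne_zero] at hroot
      exact hz hroot
    have hr : ∀ x, (2 * θ x - S) ^ 2 = S ^ 2 - 4 * c x := fun x => by rw [← h x]; ring
    have hr' : ∀ x, (2 * θ' x - S) ^ 2 = (2 * θ x - S) ^ 2 := fun x => by
      rw [hr, ← h' x, hs]; ring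
    have hr0 : ∀ x, 2 * θ x - S ≠ 0 := by
      intro x hx
      refine h4 x ?_
      have := hr x
      rw [hx] at this
      rwa [show 4 * c x = S ^ 2 by linear_combination this]
    have hsign : ∀ x, ∃ e : ℤˣ, 2 * θ' x - S = ((e : ℤ) : ℂ) * (2 * θ x - S) := fun x => by
      rcases sq_eq_sq_iff_eq_or_eq_neg.mp (hr' x) with hx | hx
      · exact ⟨1, by simpa using hx⟩
      · exact ⟨-1, by simpa using hx⟩
    choose ε hε using hsign
    by_contra hne
    have hε1 : ε ≠ 1 := by
      rintro rfl
      refine hne (funext fun x => ?_)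
      have := hε x
      simp only [Pi.one_apply, Units.val_one, Int.cast_one, one_mul] at this
      linear_combination this / 2
    have hlin : ∀ ϑ : V → ℂ, ∑ y, ϑ y = S →
        ((Fintype.card V : ℂ) - 2) * S + ∑ x, (2 * ϑ x - S) = 0 := fun ϑ hϑ => by
      simp only [Finset.sum_sub_distrib, ← Finset.mul_sum, Finset.sum_const, Finset.card_univ,
        nsmul_eq_mul, hϑ]
      ring
    have hder := derivative_elimPoly_eq_zero (r := fun x => 2 * θ x - S) rfl hr hS0 hr0 hε1
      (by simp_rw [← hε]; exact hlin θ' hs) (by simpa using hlin θ rfl)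
    exact hsep.eval₂_derivative_ne_zero (RingHom.id ℂ) (x := S ^ 2) hroot hder
  rcases sq_eq_sq_iff_eq_or_eq_neg.mp hs with hs | hs
  · exact Or.inl (key θ' h' hs.symm)
  · refine Or.inr (neg_eq_iff_eq_neg.mp (key (-θ') (fun x => ?_) ?_))
    · rw [← h' x]
      simp only [Pi.neg_apply, Finset.sum_neg_distrib]
      ring
    · simp only [Pi.neg_apply, Finset.sum_neg_distrib]
      exact hs.symm

/-- The solutions for one block correspond to the roots of the elimination polynomial. -/
theorem encard_blockSolutions (hV : 3 ≤ Fintype.card V) {c : V → ℂ} (h0 : ∀ x, c x ≠ 0)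
    (hc : ∀ x, ∑ y, c y ≠ 2 * c x) (hsep : (elimPoly c).Separable)
    (hz : (elimPoly c).eval 0 ≠ 0) (h4 : ∀ x, (elimPoly c).eval (4 * c x) ≠ 0) :
    (blockSolutions c).encard = (2 ^ (Fintype.card V - 1) - Fintype.card V : ℕ) := by
  have hp0 : elimPoly c ≠ 0 := hsep.ne_zero
  have hroots : ((elimPoly c).roots.toFinset : Set ℂ).encard =
      (2 ^ (Fintype.card V - 1) - Fintype.card V : ℕ) := by
    rw [Set.encard_coe_eq_coe_finsetCard, Multiset.toFinset_card_of_nodup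
      (Polynomial.nodup_roots hsep), ← IsAlgClosed.splits (elimPoly c) |>.natDegree_eq_card_roots,
      natDegree_elimPoly hc]
  have hmem : ∀ s ∈ ((elimPoly c).roots.toFinset : Set ℂ), (elimPoly c).eval s = 0 := by
    intro s hs
    have hs : s ∈ (elimPoly c).roots.toFinset := hs
    rw [Multiset.mem_toFinset, Polynomial.mem_roots hp0] at hs
    exact hs
  choose! θ hθ hsq using fun s (hs : s ∈ ((elimPoly c).roots.toFinset : Set ℂ)) =>
    exists_solution_of_eval_elimPoly (hmem s hs)
  have hneg : ∀ θ : V → ℂ, rankOne (-θ) = rankOne θ := fun θ => by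
    funext x y; simp [rankOne]
  rw [← hroots]
  have hbij : Set.BijOn (fun s => rankOne (θ s)) ((elimPoly c).roots.toFinset : Set ℂ)
      (blockSolutions c) := by
    refine ⟨fun s hs => rankOne_mem (hθ s hs), ?_, ?_⟩
    · intro s hs s' hs' heq
      have hq := rankOne_mem (hθ s hs)
      rw [← hsq s hs, ← hsq s' hs']
      rcases eq_or_eq_neg_of_rankOne_eq hV (fun x y hxy => blockSolutions_ne_zero h0 hc hq hxy) heq with h | h
      · rw [h]
      · rw [h]; simp
    · intro q hq
      obtain ⟨ϑ, rfl, hϑ⟩ := blockSolutions_exists_eq_rankOne hV h0 hc hq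
      have hs : (∑ y, ϑ y) ^ 2 ∈ ((elimPoly c).roots.toFinset : Set ℂ) := by
        rw [Finset.mem_coe, Multiset.mem_toFinset, Polynomial.mem_roots hp0]
        exact eval_elimPoly_of_solution hϑ
      refine ⟨_, hs, ?_⟩
      rcases eq_or_eq_neg_of_sq_sum_eq hsep hz h4 hϑ (hθ _ hs) (hsq _ hs).symm with h | h
      · simp only [h]
      · simp only [h, hneg]
  rw [← hbij.image_eq, hbij.injOn.encard_image]

theorem generically_encard_blockSolutions (hV : 3 ≤ Fintype.card V) :
    Generically (fun c : V → ℂ => (blockSolutions c).encard =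
      (2 ^ (Fintype.card V - 1) - Fintype.card V : ℕ)) := by
  have h0 : Generically (fun c : V → ℂ => ∀ x, c x ≠ 0) := Generically.forall fun x =>
    generically_linearMap_ne_zero (LinearMap.proj x) 1 (by simp)
  have h1 : Generically (fun c : V → ℂ => ∀ x, ∑ y, c y ≠ 2 * c x) := Generically.forall fun x =>
    (generically_linearMap_ne_zero ((∑ y, LinearMap.proj y) - (2 : ℂ) • LinearMap.proj x)
      (Pi.single x 1) (by simp; norm_num)).mono fun c hc => by
        simpa [sub_ne_zero] using hc
  refine ((h0.and h1).and (generically_elimPoly hV)).mono fun c hc => ?_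
  exact encard_blockSolutions hV hc.1.1 hc.1.2 hc.2.1 hc.2.2.1 hc.2.2.2

end OneBlock

/-! ### Dyad vectors as symmetric tables -/

section Tables

variable {k : ℕ} {n : Fin k → ℕ}

theorem coord_of_ne (p : Dyad n → ℂ) {x y : Vertex n} (h : x ≠ y) :
    coord p x y = p (dyad x y h) := dif_pos h

theorem coord_self (p : Dyad n → ℂ) (x : Vertex n) : coord p x x = 0 := dif_neg (by simp)

theorem coord_comm (p : Dyad n → ℂ) (x y : Vertex n) : coord p x y = coord p y x := by
  by_cases h : x = y
  · rw [h]
  · rw [coord_of_ne p h, coord_of_ne p (Ne.symm h)]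
    exact congrArg p (Subtype.ext Sym2.eq_swap)

theorem coord_sub (p u : Dyad n → ℂ) (x y : Vertex n) :
    coord (p - u) x y = coord p x y - coord u x y := by
  unfold coord; split_ifs <;> simp

theorem ext_coord {p p' : Dyad n → ℂ} (h : ∀ x y, x ≠ y → coord p x y = coord p' x y) :
    p = p' := by
  funext ⟨e, he⟩
  induction e using Sym2.ind with
  | _ x y =>
    have hxy : x ≠ y := fun h => he (Sym2.mk_isDiag_iff.mpr h)
    have := h x y hxy
    rwa [coord_of_ne p hxy, coord_of_ne p' hxy] at this

/-- The coordinate of a dyad vector, as a linear form. -/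
def coordLinear (x y : Vertex n) : (Dyad n → ℂ) →ₗ[ℂ] ℂ where
  toFun p := coord p x y
  map_add' p q := by unfold coord; split_ifs <;> simp
  map_smul' a p := by unfold coord; split_ifs <;> simp

theorem coordLinear_apply (x y : Vertex n) (p : Dyad n → ℂ) :
    coordLinear x y p = coord p x y := rfl

/-- The dyad vector with the off-diagonal entries of a symmetric table. -/
def ofTable (q : Vertex n → Vertex n → ℂ) (hq : ∀ x y, q x y = q y x) : Dyad n → ℂ :=
  fun e => Sym2.lift ⟨q, hq⟩ e.1

theorem coord_ofTable (q : Vertex n → Vertex n → ℂ) (hq : ∀ x y, q x y = q y x) {x y : Vertex n}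
    (h : x ≠ y) : coord (ofTable q hq) x y = q x y := by
  rw [coord_of_ne _ h]; rfl

/-- Every dyad is counted twice in a sum over ordered pairs. -/
theorem sum_sum_coord (F : Sym2 (Vertex n) → ℂ) (p : Dyad n → ℂ) :
    ∑ x, ∑ y, F s(x, y) * coord p x y = 2 * ∑ e : Dyad n, F e.1 * p e := by
  let P : Sym2 (Vertex n) → ℂ := fun z => if h : ¬ z.IsDiag then F z * p ⟨z, h⟩ else 0
  have hP : ∀ x y, F s(x, y) * coord p x y = P s(x, y) := by
    intro x y
    by_cases h : x = y
    · subst h; simp [P, coord_self]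
    · rw [coord_of_ne p h]
      simp only [P, Sym2.mk_isDiag_iff, h, not_false_eq_true, dif_pos]
      rfl
  have hsub : ∑ e : Dyad n, F e.1 * p e = ∑ z, P z := by
    rw [← Fintype.sum_subtype_add_sum_subtype (fun z : Sym2 (Vertex n) => ¬ z.IsDiag) P]
    rw [Finset.sum_eq_zero (s := (Finset.univ : Finset {z : Sym2 (Vertex n) // ¬¬ z.IsDiag}))
      (fun z _ => dif_neg z.2), add_zero]
    refine Finset.sum_congr (by congr) fun e _ => ?_
    simp only [P]
    rw [dif_pos e.2]
  simp_rw [hP]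
  rw [hsub, ← Fintype.sum_prod_type' (f := fun x y => P s(x, y)),
    ← Finset.sum_fiberwise (s := Finset.univ) (g := fun a : Vertex n × Vertex n => s(a.1, a.2)),
    Finset.mul_sum]
  refine Finset.sum_congr rfl fun z _ => ?_
  rw [Finset.sum_congr rfl (g := fun _ => P z) (fun a ha => by rw [(Finset.mem_filter.mp ha).2]),
    Finset.sum_const, nsmul_eq_mul]
  by_cases hz : z.IsDiag
  · have : P z = 0 := dif_neg (not_not.mpr hz)
    rw [this, mul_zero, mul_zero]
  · congr 1
    induction z using Sym2.ind with
    | _ x y =>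
      have hxy : x ≠ y := fun h => hz (Sym2.mk_isDiag_iff.mpr h)
      have : (Finset.univ.filter fun a : Vertex n × Vertex n => s(a.1, a.2) = s(x, y)) =
          {(x, y), (y, x)} := by
        ext ⟨a, b⟩
        simp
      rw [this, Finset.card_pair (by simp [hxy])]
      norm_num

/-- The sum of the entries between two blocks (twice the sum over dyads if the blocks agree). -/
def blockSum (p : Dyad n → ℂ) (i j : Fin k) : ℂ :=
  ∑ v, ∑ w, coord p ⟨i, v⟩ ⟨j, w⟩

theorem designMatrix_inl (d : Dyad n → ℂ) (x : Vertex n) :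
    (designMatrix n).mulVec d (Sum.inl x) = ∑ y, coord d x y := by
  have h := sum_sum_coord (fun z => if x ∈ z then 1 else 0) d
  have h2 : ∀ a b, (if x ∈ s(a, b) then 1 else 0 : ℂ) * coord d a b =
      (if a = x then coord d x b else 0) + (if b = x then coord d x a else 0) := by
    intro a b
    by_cases ha : a = x
    · subst ha
      by_cases hb : b = a
      · subst hb; simp [coord_self]
      · simp [hb]
    · by_cases hb : b = x
      · subst hb; simp [ha, coord_comm d a]
      · simp [ha, hb, Ne.symm ha, Ne.symm hb]
  simp_rw [h2, Finset.sum_add_distrib] at h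
  rw [Finset.sum_comm] at h
  simp only [Finset.sum_ite_eq', Finset.mem_univ, if_true] at h
  have h3 : (designMatrix n).mulVec d (Sum.inl x) =
      ∑ e : Dyad n, (if x ∈ e.1 then 1 else 0) * d e := rfl
  rw [h3]
  linear_combination -h / 2

theorem designMatrix_inr (d : Dyad n → ℂ) (i j : Fin k) :
    (designMatrix n).mulVec d (Sum.inr s(i, j)) = 0 ↔ blockSum d i j = 0 := by
  have h := sum_sum_coord (fun z => if Sym2.map Sigma.fst z = s(i, j) then 1 else 0) d
  have h3 : (designMatrix n).mulVec d (Sum.inr s(i, j)) =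
      ∑ e : Dyad n, (if Sym2.map Sigma.fst e.1 = s(i, j) then 1 else 0) * d e := rfl
  rw [h3]
  have hcomm : blockSum d j i = blockSum d i j := by
    unfold blockSum
    rw [Finset.sum_comm]
    simp_rw [coord_comm d ⟨j, _⟩]
  have h2 : ∀ a b : Vertex n, (if Sym2.map Sigma.fst s(a, b) = s(i, j) then 1 else 0 : ℂ)
      * coord d a b = (if a.1 = i then if b.1 = j then coord d a b else 0 else 0) +
        (if i = j then 0 else if a.1 = j then if b.1 = i then coord d a b else 0 else 0) := by
    intro a b
    simp only [Sym2.map_mk, Sym2.eq_iff]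
    by_cases hij : i = j
    · subst hij
      by_cases ha : a.1 = i <;> by_cases hb : b.1 = i <;> simp [ha, hb]
    · by_cases ha : a.1 = i
      · have : a.1 ≠ j := fun h => hij (ha.symm.trans h)
        by_cases hb : b.1 = j <;> simp [ha, hb, hij]
      · by_cases ha' : a.1 = j <;> by_cases hb : b.1 = i <;> simp [ha, ha', hb, hij, Ne.symm hij]
  have hsum : ∀ i' j' : Fin k, ∑ a : Vertex n, ∑ b : Vertex n,
      (if a.1 = i' then if b.1 = j' then coord d a b else 0 else 0) = blockSum d i' j' := by
    intro i' j'
    simp only [Fintype.sum_sigma]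
    rw [Finset.sum_eq_single i' (fun a _ ha => by simp [ha]) (by simp)]
    refine Finset.sum_congr rfl fun v _ => ?_
    rw [Finset.sum_eq_single j' (fun a _ ha => by simp [ha]) (by simp)]
    simp
  simp_rw [h2, Finset.sum_add_distrib, hsum] at h
  by_cases hij : i = j
  · simp only [hij, if_true, Finset.sum_const_zero, add_zero] at h ⊢
    rw [h]; simp
  · simp only [hij, if_false, hsum, hcomm] at h
    have h' : blockSum d i j = ∑ e : Dyad n,
        (if Sym2.map Sigma.fst e.1 = s(i, j) then 1 else 0) * d e := by linear_combination h / 2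
    rw [h']

/-- The linear likelihood equations: equal degrees, and equal sums between blocks. -/
theorem designMatrix_mulVec_sub_eq_zero_iff (p u : Dyad n → ℂ) :
    (designMatrix n).mulVec (p - u) = 0 ↔
      (∀ x, ∑ y, coord p x y = ∑ y, coord u x y) ∧ ∀ i j, blockSum p i j = blockSum u i j := by
  have hb : ∀ i j, blockSum (p - u) i j = blockSum p i j - blockSum u i j := fun i j => by
    simp only [blockSum, coord_sub, Finset.sum_sub_distrib]
  have hd : ∀ x, (∑ y, coord (p - u) x y) = ∑ y, coord p x y - ∑ y, coord u x y := fun x => by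
    simp only [coord_sub, Finset.sum_sub_distrib]
  constructor
  · intro h
    refine ⟨fun x => ?_, fun i j => ?_⟩
    · have := congrFun h (Sum.inl x)
      rw [designMatrix_inl, hd] at this
      exact sub_eq_zero.mp this
    · have := (designMatrix_inr (p - u) i j).mp (congrFun h (Sum.inr s(i, j)))
      rw [hb] at this
      exact sub_eq_zero.mp this
  · rintro ⟨h1, h2⟩
    funext r
    rcases r with x | z
    · rw [designMatrix_inl, hd, h1, sub_self]; rfl
    · induction z using Sym2.ind with
      | _ i j => exact (designMatrix_inr (p - u) i j).mpr (by rw [hb, h2, sub_self])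

end Tables

/-! ### Splitting the likelihood equations into blocks -/

section Blocks

variable {k : ℕ} {n : Fin k → ℕ}

/-- The sum of the entries from the vertex `v` of block `i` to all other blocks. -/
def crossSum (p : Dyad n → ℂ) (i : Fin k) (v : Fin (n i)) : ℂ :=
  ∑ j, if j = i then 0 else ∑ w, coord p ⟨i, v⟩ ⟨j, w⟩

/-- The sum of the entries from block `i` to all other blocks. -/
def outSum (p : Dyad n → ℂ) (i : Fin k) : ℂ := ∑ v, crossSum p i v

theorem outSum_eq (p : Dyad n → ℂ) (i : Fin k) :
    outSum p i = ∑ j, if j = i then 0 else blockSum p i j := by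
  unfold outSum crossSum
  rw [Finset.sum_comm]
  refine Finset.sum_congr rfl fun j _ => ?_
  split_ifs <;> simp [blockSum]

theorem sum_coord_eq (p : Dyad n → ℂ) (i : Fin k) (v : Fin (n i)) :
    ∑ y, coord p ⟨i, v⟩ y = ∑ w, coord p ⟨i, v⟩ ⟨i, w⟩ + crossSum p i v := by
  rw [Fintype.sum_sigma, ← Finset.add_sum_erase _ _ (Finset.mem_univ i), crossSum,
    ← Finset.add_sum_erase _ _ (Finset.mem_univ i), if_pos rfl, zero_add]
  congr 1
  refine Finset.sum_congr rfl fun j hj => ?_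
  rw [if_neg (Finset.ne_of_mem_erase hj)]

theorem blockSum_comm (p : Dyad n → ℂ) (i j : Fin k) : blockSum p i j = blockSum p j i := by
  unfold blockSum
  rw [Finset.sum_comm]
  simp_rw [coord_comm p ⟨i, _⟩]

/-- The table of block `i`, in which all other blocks are collapsed to one extra vertex `none`. -/
def blockTable (p : Dyad n → ℂ) (i : Fin k) : Option (Fin (n i)) → Option (Fin (n i)) → ℂ
  | some v, some w => coord p ⟨i, v⟩ ⟨i, w⟩
  | some v, none => crossSum p i v
  | none, some w => crossSum p i w
  | none, none => 0

/-- The row sums of the table of block `i` with the other blocks collapsed. -/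
def blockData (u : Dyad n → ℂ) (i : Fin k) : Option (Fin (n i)) → ℂ
  | some v => ∑ y, coord u ⟨i, v⟩ y
  | none => outSum u i

theorem sum_blockTable (p : Dyad n → ℂ) (i : Fin k) (o : Option (Fin (n i))) :
    ∑ o', blockTable p i o o' = blockData p i o := by
  rw [Fintype.sum_option]
  cases o with
  | none => simp [blockTable, blockData, outSum]
  | some v => simp only [blockTable, blockData, sum_coord_eq]; ring

theorem blockTable_comm (p : Dyad n → ℂ) (i : Fin k) (o o' : Option (Fin (n i))) :
    blockTable p i o o' = blockTable p i o' o := by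
  cases o <;> cases o' <;> simp [blockTable, coord_comm]

theorem blockData_congr {p u : Dyad n → ℂ} (h1 : ∀ x, ∑ y, coord p x y = ∑ y, coord u x y)
    (h2 : ∀ i j, blockSum p i j = blockSum u i j) : blockData p = blockData u := by
  funext i o
  cases o with
  | none => simp only [blockData, outSum_eq, h2]
  | some v => simp only [blockData, h1]

theorem mk_ne_of_ne {i j : Fin k} (hij : i ≠ j) (v : Fin (n i)) (w : Fin (n j)) :
    (⟨i, v⟩ : Vertex n) ≠ ⟨j, w⟩ := fun h => hij (congrArg Sigma.fst h)

theorem mk_ne {i : Fin k} {v w : Fin (n i)} (h : v ≠ w) : (⟨i, v⟩ : Vertex n) ≠ ⟨i, w⟩ :=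
  fun h' => h (by simpa using h')

/-- Collapsing turns a solution of the likelihood equations into a solution for each block. -/
theorem blockTable_mem {u p : Dyad n → ℂ} (hp : p ∈ likelihoodSolutions n u) (i : Fin k) :
    blockTable p i ∈ blockSolutions (blockData u i) := by
  obtain ⟨hlin, hW, h31, -, -⟩ := hp
  obtain ⟨h1, h2⟩ := (designMatrix_mulVec_sub_eq_zero_iff p u).mp hlin
  have key : ∀ t u v : Fin (n i), t ≠ u → t ≠ v → u ≠ v →
      crossSum p i t * coord p ⟨i, u⟩ ⟨i, v⟩ = coord p ⟨i, t⟩ ⟨i, u⟩ * crossSum p i v := by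
    intro t u v htu htv huv
    unfold crossSum
    rw [Finset.sum_mul, Finset.mul_sum]
    refine Finset.sum_congr rfl fun j _ => ?_
    split_ifs with hj
    · simp
    · rw [Finset.sum_mul, Finset.mul_sum]
      exact Finset.sum_congr rfl fun w _ =>
        sub_eq_zero.mp (h31 i j (Ne.symm hj) t u v w htu htv huv)
  refine ⟨blockTable_comm p i, fun o => ?_, fun o => ?_, ?_⟩
  · cases o <;> simp [blockTable, coord_self]
  · rw [sum_blockTable, blockData_congr h1 h2]
  · intro a b c d hab hac had hbc hbd hcd
    rcases a with _ | a <;> rcases b with _ | b <;> rcases c with _ | c <;> rcases d with _ | d <;>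
      first
      | exact absurd rfl ‹none ≠ none›
      | skip
    · simp only [ne_eq, Option.some.injEq] at hbc hbd hcd
      have := key b d c hbd hbc (Ne.symm hcd)
      simp only [blockTable]
      rw [coord_comm p ⟨i, c⟩]
      linear_combination this
    · simp only [ne_eq, Option.some.injEq] at hac had hcd
      have := key a c d hac had hcd
      simp only [blockTable]
      linear_combination this
    · simp only [ne_eq, Option.some.injEq] at hab had hbd
      have := key a b d hab had hbd
      simp only [blockTable]
      linear_combination -this
    · simp only [ne_eq, Option.some.injEq] at hab hac hbc
      have := key c a b (Ne.symm hac) (Ne.symm hbc) hab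
      simp only [blockTable]
      rw [coord_comm p ⟨i, c⟩] at this
      linear_combination this
    · simp only [ne_eq, Option.some.injEq] at hab hac had hbc hbd hcd
      exact sub_eq_zero.mp (hW i a b c d hab hac had hbc hbd hcd)

/-- The entries between two blocks are determined by the collapsed tables. -/
theorem coord_mul_outSum {u p : Dyad n → ℂ} (hp : p ∈ likelihoodSolutions n u)
    {i j : Fin k} (hij : i ≠ j) (v : Fin (n i)) (w : Fin (n j)) :
    coord p ⟨i, v⟩ ⟨j, w⟩ * (outSum p i * outSum p j) =
      blockSum p i j * crossSum p i v * crossSum p j w := by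
  obtain ⟨-, -, -, h22, h211⟩ := hp
  have key : ∀ {i j : Fin k}, i ≠ j → ∀ (t u : Fin (n i)) (v : Fin (n j)),
      coord p ⟨i, t⟩ ⟨j, v⟩ * crossSum p i u = coord p ⟨i, u⟩ ⟨j, v⟩ * crossSum p i t := by
    intro i j hij t u v
    by_cases htu : t = u
    · rw [htu]
    unfold crossSum
    rw [Finset.mul_sum, Finset.mul_sum]
    refine Finset.sum_congr rfl fun l _ => ?_
    split_ifs with hl
    · simp
    rw [Finset.mul_sum, Finset.mul_sum]
    refine Finset.sum_congr rfl fun w _ => ?_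
    by_cases hjl : j = l
    · subst hjl
      by_cases hvw : v = w
      · subst hvw; ring
      · linear_combination h22 i j hij t u v w htu hvw
    · linear_combination h211 i j l hij (Ne.symm hl) hjl t u v w htu
  have h1 : coord p ⟨i, v⟩ ⟨j, w⟩ * outSum p i =
      (∑ t, coord p ⟨i, t⟩ ⟨j, w⟩) * crossSum p i v := by
    unfold outSum
    rw [Finset.mul_sum, Finset.sum_mul]
    exact Finset.sum_congr rfl fun t _ => key hij v t w
  have h2 : (∑ t, coord p ⟨i, t⟩ ⟨j, w⟩) * outSum p j = blockSum p i j * crossSum p j w := by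
    unfold outSum blockSum
    rw [Finset.sum_mul, Finset.sum_mul]
    refine Finset.sum_congr rfl fun t _ => ?_
    rw [Finset.mul_sum, Finset.sum_mul]
    refine Finset.sum_congr rfl fun w' _ => ?_
    rw [coord_comm p ⟨i, t⟩, coord_comm p ⟨i, t⟩]
    exact key hij.symm w w' t
  linear_combination outSum p j * h1 + crossSum p i v * h2

/-- The table on all vertices built from tables for the blocks: rank one between blocks, with the
block sums of `u`. -/
noncomputable def glue (u : Dyad n → ℂ)
    (Q : ∀ i : Fin k, Option (Fin (n i)) → Option (Fin (n i)) → ℂ) (x y : Vertex n) : ℂ :=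
  if h : y.1 = x.1 then Q x.1 (some x.2) (some (h ▸ y.2))
  else blockSum u x.1 y.1 * Q x.1 (some x.2) none * Q y.1 (some y.2) none /
    (outSum u x.1 * outSum u y.1)

variable {u : Dyad n → ℂ} {Q : ∀ i : Fin k, Option (Fin (n i)) → Option (Fin (n i)) → ℂ}

theorem glue_same (i : Fin k) (v w : Fin (n i)) :
    glue u Q ⟨i, v⟩ ⟨i, w⟩ = Q i (some v) (some w) := dif_pos rfl

theorem glue_of_ne {i j : Fin k} (hij : i ≠ j) (v : Fin (n i)) (w : Fin (n j)) :
    glue u Q ⟨i, v⟩ ⟨j, w⟩ = blockSum u i j * Q i (some v) none * Q j (some w) none /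
      (outSum u i * outSum u j) := dif_neg (Ne.symm hij)

theorem glue_comm (hQ : ∀ i, Q i ∈ blockSolutions (blockData u i)) (x y : Vertex n) :
    glue u Q x y = glue u Q y x := by
  obtain ⟨i, v⟩ := x
  obtain ⟨j, w⟩ := y
  by_cases hij : i = j
  · subst hij
    rw [glue_same, glue_same, (hQ i).1]
  · rw [glue_of_ne hij, glue_of_ne (Ne.symm hij), blockSum_comm]
    ring

theorem coord_glue (hQ : ∀ i, Q i ∈ blockSolutions (blockData u i)) (x y : Vertex n) :
    coord (ofTable (glue u Q) (glue_comm hQ)) x y = glue u Q x y := by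
  by_cases h : x = y
  · subst h
    rw [coord_self, glue_same, (hQ x.1).2.1]
  · exact coord_ofTable _ _ h

theorem crossSum_glue (hQ : ∀ i, Q i ∈ blockSolutions (blockData u i))
    (hu : ∀ i, outSum u i ≠ 0) (i : Fin k) (v : Fin (n i)) :
    crossSum (ofTable (glue u Q) (glue_comm hQ)) i v = Q i (some v) none := by
  have hnone : ∀ j, ∑ w, Q j (some w) none = outSum u j := fun j => by
    have := (hQ j).2.2.1 none
    rw [Fintype.sum_option, (hQ j).2.1, zero_add] at this
    simp_rw [(hQ j).1 none] at this
    exact this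
  have h : ∀ j, (if j = i then 0 else ∑ w, coord (ofTable (glue u Q) (glue_comm hQ)) ⟨i, v⟩ ⟨j, w⟩)
      = Q i (some v) none / outSum u i * (if j = i then 0 else blockSum u i j) := by
    intro j
    split_ifs with hj
    · simp
    · simp_rw [coord_glue hQ, glue_of_ne (Ne.symm hj)]
      rw [← Finset.sum_div, ← Finset.mul_sum, hnone]
      have := hu i
      have := hu j
      field_simp
  unfold crossSum
  simp_rw [h]
  rw [← Finset.mul_sum, ← outSum_eq, div_mul_cancel₀ _ (hu i)]

/-- Solutions for the blocks glue to a solution of the likelihood equations. -/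
theorem ofTable_glue_mem (hQ : ∀ i, Q i ∈ blockSolutions (blockData u i))
    (hu : ∀ i, outSum u i ≠ 0) :
    ofTable (glue u Q) (glue_comm hQ) ∈ likelihoodSolutions n u := by
  have hdeg : ∀ x, ∑ y, coord (ofTable (glue u Q) (glue_comm hQ)) x y = ∑ y, coord u x y := by
    rintro ⟨i, v⟩
    have := (hQ i).2.2.1 (some v)
    rw [Fintype.sum_option] at this
    rw [sum_coord_eq, crossSum_glue hQ hu]
    simp_rw [coord_glue hQ, glue_same]
    rw [add_comm]
    exact this
  have hnone : ∀ j, ∑ w, Q j (some w) none = outSum u j := fun j => by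
    have := (hQ j).2.2.1 none
    rw [Fintype.sum_option, (hQ j).2.1, zero_add] at this
    simp_rw [(hQ j).1 none] at this
    exact this
  refine ⟨(designMatrix_mulVec_sub_eq_zero_iff _ _).mpr ⟨hdeg, fun i j => ?_⟩, ?_, ?_, ?_, ?_⟩
  · by_cases hij : i = j
    · subst hij
      have h1 : ∀ p : Dyad n → ℂ, blockSum p i i =
          ∑ v, ∑ y, coord p ⟨i, v⟩ y - outSum p i := fun p => by
        simp_rw [sum_coord_eq, Finset.sum_add_distrib, outSum, blockSum]
        ring
      rw [h1, h1]
      simp_rw [hdeg]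
      congr 1
      unfold outSum
      simp_rw [crossSum_glue hQ hu]
      exact hnone i
    · unfold blockSum
      simp_rw [coord_glue hQ, glue_of_ne hij]
      have hi := hu i
      have hj := hu j
      calc ∑ v, ∑ w, blockSum u i j * Q i (some v) none * Q j (some w) none /
            (outSum u i * outSum u j)
          = blockSum u i j * (∑ v, Q i (some v) none) * (∑ w, Q j (some w) none) /
            (outSum u i * outSum u j) := by
            rw [mul_assoc, Finset.sum_mul_sum, Finset.mul_sum, Finset.sum_div]
            simp_rw [Finset.mul_sum, Finset.sum_div, mul_assoc]
        _ = blockSum u i j := by rw [hnone, hnone]; field_simp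
  · intro i t a b c h1 h2 h3 h4 h5 h6
    simp_rw [coord_glue hQ, glue_same]
    have hs : ∀ {v w : Fin (n i)}, v ≠ w → some v ≠ some w := fun h h' => h (Option.some.inj h')
    exact sub_eq_zero.mpr ((hQ i).2.2.2 _ _ _ _ (hs h1) (hs h2) (hs h3) (hs h4) (hs h5) (hs h6))
  · intro i j hij t a b w h1 h2 h3
    simp_rw [coord_glue hQ, glue_same, glue_of_ne hij]
    have hs : ∀ {v w : Fin (n i)}, v ≠ w → some v ≠ some w := fun h h' => h (Option.some.inj h')
    have h := (hQ i).2.2.2 (some t) none (some a) (some b) (by simp) (hs h1) (hs h2) (by simp)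
      (by simp) (hs h3)
    rw [(hQ i).1 none] at h
    linear_combination blockSum u i j * Q j (some w) none / (outSum u i * outSum u j) * h
  · intro i j hij t a v w _ _
    simp_rw [coord_glue hQ, glue_of_ne hij]
    ring
  · intro i j l hij hil _ t a v w _
    simp_rw [coord_glue hQ, glue_of_ne hij, glue_of_ne hil]
    ring

theorem blockTable_glue (hQ : ∀ i, Q i ∈ blockSolutions (blockData u i))
    (hu : ∀ i, outSum u i ≠ 0) :
    (fun i => blockTable (ofTable (glue u Q) (glue_comm hQ)) i) = Q := by
  funext i o o'
  rcases o with _ | v <;> rcases o' with _ | w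
  · exact ((hQ i).2.1 none).symm
  · simp only [blockTable]
    rw [crossSum_glue hQ hu, (hQ i).1]
  · simp only [blockTable]
    rw [crossSum_glue hQ hu]
  · simp only [blockTable]
    rw [coord_glue hQ, glue_same]

theorem outSum_eq_of_mem {p : Dyad n → ℂ} (hp : p ∈ likelihoodSolutions n u) (i : Fin k) :
    outSum p i = outSum u i := by
  simp_rw [outSum_eq, ((designMatrix_mulVec_sub_eq_zero_iff p u).mp hp.1).2]

/-- The solutions of the likelihood equations are the families of solutions for the blocks. -/
theorem bijOn_blockTable (hu : ∀ i, outSum u i ≠ 0) :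
    Set.BijOn (fun p : Dyad n → ℂ => fun i => blockTable p i) (likelihoodSolutions n u)
      (Set.univ.pi fun i => blockSolutions (blockData u i)) := by
  refine ⟨fun p hp i _ => blockTable_mem hp i, fun p hp p' hp' heq => ext_coord ?_, fun Q hQ => ?_⟩
  · have hT : ∀ i o o', blockTable p i o o' = blockTable p' i o o' := fun i o o' =>
      congrFun (congrFun (congrFun heq i) o) o'
    rintro ⟨i, v⟩ ⟨j, w⟩ -
    by_cases hij : i = j
    · subst hij
      exact hT i (some v) (some w)
    · have h := coord_mul_outSum hp hij v w
      have h' := coord_mul_outSum hp' hij v w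
      have hc : ∀ i v, crossSum p i v = crossSum p' i v := fun i v => hT i (some v) none
      rw [hc, hc, ((designMatrix_mulVec_sub_eq_zero_iff p u).mp hp.1).2 i j,
        outSum_eq_of_mem hp, outSum_eq_of_mem hp] at h
      rw [((designMatrix_mulVec_sub_eq_zero_iff p' u).mp hp'.1).2 i j,
        outSum_eq_of_mem hp', outSum_eq_of_mem hp'] at h'
      exact mul_right_cancel₀ (mul_ne_zero (hu i) (hu j)) (h.trans h'.symm)
  · have hQ' : ∀ i, Q i ∈ blockSolutions (blockData u i) := fun i => hQ i (Set.mem_univ i)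
    exact ⟨_, ofTable_glue_mem hQ' hu, blockTable_glue hQ' hu⟩

theorem encard_univ_pi {ι : Type} [Fintype ι] {α : ι → Type} (s : ∀ i, Set (α i)) (d : ι → ℕ)
    (h : ∀ i, (s i).encard = d i) : (Set.univ.pi s).encard = (∏ i, d i : ℕ) := by
  have hfin : (Set.univ.pi s).Finite :=
    Set.Finite.pi' (fun i => Set.finite_of_encard_eq_coe (h i)) |>.subset fun f hf i => hf i trivial
  rw [← hfin.cast_ncard_eq, ← Nat.card_coe_set_eq, Nat.card_congr (Equiv.Set.univPi s),
    Nat.card_pi]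
  congr 1
  refine Finset.prod_congr rfl fun i _ => ?_
  rw [Nat.card_coe_set_eq, Set.ncard, h i]
  rfl

end Blocks

/-! ### Generic data and the maximum likelihood degree -/

section Count

/-- The maximum likelihood degree of a single block with `m` vertices. -/
def oneBlockDegree (m : ℕ) : ℕ := if m = 2 then 1 else 2 ^ (m - 1) - m

/-- Every vector is the vector of row sums of a symmetric table with zero diagonal. -/
theorem exists_table_rowSum {V : Type} [Fintype V] [DecidableEq V] (hV : 3 ≤ Fintype.card V)
    (c : V → ℂ) : ∃ q : V → V → ℂ, (∀ x y, q x y = q y x) ∧ (∀ x, q x x = 0) ∧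
      ∀ x, ∑ y, q x y = c x := by
  have h2 : (Fintype.card V : ℂ) - 2 ≠ 0 := by
    rw [sub_ne_zero]; exact_mod_cast (by omega : Fintype.card V ≠ 2)
  have h1 : (Fintype.card V : ℂ) - 1 ≠ 0 := by
    rw [sub_ne_zero]; exact_mod_cast (by omega : Fintype.card V ≠ 1)
  set N : ℂ := (Fintype.card V : ℂ) with hN
  let f : V → V → ℂ := fun x y => (c x + c y) / (N - 2) - (∑ z, c z) / ((N - 1) * (N - 2))
  refine ⟨fun x y => if x = y then 0 else f x y, fun x y => ?_, fun x => by simp, fun x => ?_⟩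
  · by_cases h : x = y
    · simp [h]
    · simp only [h, Ne.symm h, if_false, f, add_comm]
  · have h : ∀ y, (if x = y then 0 else f x y) = f x y - if x = y then f x y else 0 := fun y => by
      split_ifs <;> simp
    simp_rw [h, Finset.sum_sub_distrib]
    simp only [Finset.sum_ite_eq, Finset.mem_univ, if_true, f, Finset.sum_sub_distrib,
      ← Finset.sum_div, Finset.sum_add_distrib, Finset.sum_const, Finset.card_univ, nsmul_eq_mul]
    rw [← hN]
    field_simp
    ring

/-- With two vertices the single entry is the common row sum. -/
theorem encard_blockSolutions_of_card_eq_two {V : Type} [Fintype V] (hV : Fintype.card V = 2)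
    {c : V → ℂ} (hc : ∀ x y, c x = c y) : (blockSolutions c).encard = 1 := by
  classical
  obtain ⟨a, b, hab, huniv⟩ := Finset.card_eq_two.mp (Finset.card_univ (α := V) ▸ hV)
  have hmem : ∀ x : V, x = a ∨ x = b := fun x => by
    have := Finset.mem_univ x
    rw [huniv] at this
    simpa using this
  rw [Set.encard_eq_one]
  refine ⟨fun x y => if x = y then 0 else c a, Set.ext fun q => ⟨fun hq => ?_, ?_⟩⟩
  · obtain ⟨hsymm, hdiag, hsum, -⟩ := hq
    have h := hsum a
    rw [huniv, Finset.sum_pair hab, hdiag, zero_add] at h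
    refine Set.mem_singleton_iff.mpr (funext fun x => funext fun y => ?_)
    rcases hmem x with rfl | rfl <;> rcases hmem y with rfl | rfl
    · simp [hdiag]
    · rw [if_neg hab, h]
    · rw [if_neg (Ne.symm hab), hsymm, h]
    · simp [hdiag]
  · rintro rfl
    refine ⟨fun x y => by simp only [eq_comm], fun x => by simp, fun x => ?_, ?_⟩
    · rw [huniv, Finset.sum_pair hab, hc x a]
      rcases hmem x with rfl | rfl
      · simp [hab]
      · simp [Ne.symm hab]
    · intro t u v w h1 h2 _ h4 _ _
      rcases hmem t with rfl | rfl <;> rcases hmem u with rfl | rfl <;>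
        rcases hmem v with rfl | rfl <;> simp_all

variable {k : ℕ} {n : Fin k → ℕ}

/-- For a single block the likelihood equations are the equations `blockSolutions` of the row
sums. -/
theorem encard_likelihoodSolutions_of_subsingleton [Subsingleton (Fin k)] (u : Dyad n → ℂ) :
    (likelihoodSolutions n u).encard = (blockSolutions fun x => ∑ y, coord u x y).encard := by
  have hbij : Set.BijOn (fun p : Dyad n → ℂ => coord p) (likelihoodSolutions n u)
      (blockSolutions fun x => ∑ y, coord u x y) := by
    refine ⟨fun p hp => ?_, fun p _ p' _ h => ext_coord fun x y _ => ?_, fun q hq => ?_⟩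
    · refine ⟨coord_comm p, coord_self p,
        ((designMatrix_mulVec_sub_eq_zero_iff p u).mp hp.1).1, ?_⟩
      rintro ⟨i, t⟩ ⟨i', a⟩ ⟨i'', b⟩ ⟨i''', c⟩ h1 h2 h3 h4 h5 h6
      obtain rfl := Subsingleton.elim i i'
      obtain rfl := Subsingleton.elim i i''
      obtain rfl := Subsingleton.elim i i'''
      have hs : ∀ {v w : Fin (n i)}, (⟨i, v⟩ : Vertex n) ≠ ⟨i, w⟩ → v ≠ w :=
        fun h h' => h (by rw [h'])
      exact sub_eq_zero.mp (hp.2.1 i t a b c (hs h1) (hs h2) (hs h3) (hs h4) (hs h5) (hs h6))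
    · exact congrFun (congrFun h x) y
    · obtain ⟨hsymm, hdiag, hsum, hquad⟩ := hq
      have hcoord : coord (ofTable q hsymm) = q := by
        funext x y
        by_cases h : x = y
        · rw [h, coord_self, hdiag]
        · exact coord_ofTable q hsymm h
      refine ⟨ofTable q hsymm, ⟨(designMatrix_mulVec_sub_eq_zero_iff _ _).mpr ⟨?_, ?_⟩, ?_,
        fun i j hij => absurd (Subsingleton.elim i j) hij,
        fun i j hij => absurd (Subsingleton.elim i j) hij,
        fun i j _ hij => absurd (Subsingleton.elim i j) hij⟩, hcoord⟩
      · simpa only [hcoord] using hsum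
      · intro i j
        obtain rfl := Subsingleton.elim i j
        have h1 : ∀ p : Dyad n → ℂ, blockSum p i i = ∑ v, ∑ y, coord p ⟨i, v⟩ y := fun p => by
          refine Finset.sum_congr rfl fun v _ => ?_
          have h0 : crossSum p i v = 0 :=
            Finset.sum_eq_zero fun j _ => if_pos (Subsingleton.elim j i)
          rw [sum_coord_eq, h0, add_zero]
        rw [h1, h1, hcoord]
        exact Finset.sum_congr rfl fun v _ => hsum _
      · intro i t a b c h1 h2 h3 h4 h5 h6
        rw [hcoord]
        exact sub_eq_zero.mpr (hquad _ _ _ _ (mk_ne h1) (mk_ne h2) (mk_ne h3) (mk_ne h4)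
          (mk_ne h5) (mk_ne h6))
  rw [← hbij.image_eq, hbij.injOn.encard_image]

theorem hasMLDegree_of_subsingleton [Subsingleton (Fin k)] (h : 2 ≤ ∑ i, n i) :
    HasMLDegree n (oneBlockDegree (∑ i, n i)) := by
  have hcard : Fintype.card (Vertex n) = ∑ i, n i := by simp
  change Generically _
  simp_rw [encard_likelihoodSolutions_of_subsingleton, ← hcard]
  rw [← hcard] at h
  unfold oneBlockDegree
  split_ifs with h2
  · refine generically_of_forall fun u => ?_
    rw [encard_blockSolutions_of_card_eq_two h2]
    · rfl
    · intro x y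
      by_cases hxy : x = y
      · rw [hxy]
      have huniv : (Finset.univ : Finset (Vertex n)) = {x, y} := by
        symm
        rw [← Finset.card_eq_iff_eq_univ, Finset.card_pair hxy, h2]
      rw [huniv, Finset.sum_pair hxy, Finset.sum_pair hxy, coord_self, coord_self, coord_comm]
      ring
  · have : Nonempty (Vertex n) := Fintype.card_pos_iff.mp (by omega)
    have h3 : 3 ≤ Fintype.card (Vertex n) := by omega
    have hT : ∀ u : Dyad n → ℂ, (LinearMap.pi fun x => ∑ y, coordLinear x y) u =
        fun x => ∑ y, coord u x y := fun u => by
      funext x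
      simp [coordLinear_apply]
    refine ((generically_encard_blockSolutions h3).comp_linearMap
      (LinearMap.pi fun x => ∑ y, coordLinear x y) fun c => ?_).mono fun u hu => by
        rwa [hT] at hu
    obtain ⟨q, hsymm, hdiag, hsum⟩ := exists_table_rowSum h3 c
    refine ⟨ofTable q hsymm, funext fun x => ?_⟩
    rw [← hsum x, hT]
    refine Finset.sum_congr rfl fun y _ => ?_
    by_cases hxy : x = y
    · rw [hxy, coord_self, hdiag]
    · exact coord_ofTable q hsymm hxy

/-- The sum over the entries to other blocks, as a linear form. -/
def crossLinear (i : Fin k) (v : Fin (n i)) : (Dyad n → ℂ) →ₗ[ℂ] ℂ :=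
  ∑ j, if j = i then 0 else ∑ w, coordLinear ⟨i, v⟩ ⟨j, w⟩

theorem crossLinear_apply (i : Fin k) (v : Fin (n i)) (u : Dyad n → ℂ) :
    crossLinear i v u = crossSum u i v := by
  simp only [crossLinear, crossSum, LinearMap.sum_apply]
  refine Finset.sum_congr rfl fun j _ => ?_
  split_ifs <;> simp [coordLinear_apply]

/-- The row sums of the collapsed table of block `i`, as a linear map. -/
def blockDataLinear (i : Fin k) : (Dyad n → ℂ) →ₗ[ℂ] (Option (Fin (n i)) → ℂ) :=
  LinearMap.pi fun o => o.elim (∑ v, crossLinear i v) fun v => ∑ y, coordLinear ⟨i, v⟩ y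

theorem blockDataLinear_apply (i : Fin k) (u : Dyad n → ℂ) :
    blockDataLinear i u = blockData u i := by
  funext o
  cases o <;> simp [blockDataLinear, blockData, outSum, crossLinear_apply, coordLinear_apply]

/-- The number of vertices outside block `i`. -/
def outCard (n : Fin k → ℕ) (i : Fin k) : ℕ := ∑ j, if j = i then 0 else n j

theorem outCard_pos (hk : 1 < k) (hn : ∀ i, 0 < n i) (i : Fin k) : 0 < outCard n i := by
  have : Nontrivial (Fin k) := Fin.nontrivial_iff_two_le.mpr hk
  obtain ⟨j, hj⟩ := exists_ne i
  refine Finset.sum_pos' (fun _ _ => Nat.zero_le _) ⟨j, Finset.mem_univ j, ?_⟩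
  rw [if_neg hj]
  exact hn j

/-- The map collapsing all vertices outside block `i` to `none`. -/
def collapse (i : Fin k) (x : Vertex n) : Option (Fin (n i)) :=
  if h : x.1 = i then some (h ▸ x.2) else none

theorem collapse_same (i : Fin k) (v : Fin (n i)) : collapse i (⟨i, v⟩ : Vertex n) = some v :=
  dif_pos rfl

theorem collapse_of_ne {i j : Fin k} (h : j ≠ i) (w : Fin (n j)) :
    collapse i (⟨j, w⟩ : Vertex n) = none := dif_neg h

/-- Every vector arises as row sums of a collapsed table: the entries of a table with an extra
vertex are distributed evenly over the vertices outside the block. -/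
theorem blockDataLinear_surjective (hk : 1 < k) (hn : ∀ i, 0 < n i) (i : Fin k)
    (hi : 2 ≤ n i) : Function.Surjective (blockDataLinear (n := n) i) := by
  intro c
  obtain ⟨q, hsymm, hdiag, hsum⟩ := exists_table_rowSum (V := Option (Fin (n i))) (by simp; omega) c
  have hN : (outCard n i : ℂ) ≠ 0 := Nat.cast_ne_zero.mpr (outCard_pos hk hn i).ne'
  let ω : Option (Fin (n i)) → ℂ := fun o => o.elim (outCard n i : ℂ)⁻¹ fun _ => 1
  let Q : Vertex n → Vertex n → ℂ := fun x y =>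
    q (collapse i x) (collapse i y) * (ω (collapse i x) * ω (collapse i y))
  have hQ : ∀ x y, Q x y = Q y x := fun x y => by
    simp only [Q]
    rw [hsymm]; ring
  have hcoord : ∀ x y : Vertex n, coord (ofTable Q hQ) x y = Q x y := fun x y => by
    by_cases h : x = y
    · subst h
      simp only [Q]
      rw [coord_self, hdiag, zero_mul]
    · exact coord_ofTable Q hQ h
  have hcross : ∀ v, crossSum (ofTable Q hQ) i v = q (some v) none := fun v => by
    have : ∀ j, (if j = i then 0 else ∑ w, coord (ofTable Q hQ) ⟨i, v⟩ ⟨j, w⟩) =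
        q (some v) none * (outCard n i : ℂ)⁻¹ * ((if j = i then 0 else n j : ℕ) : ℂ) := fun j => by
      split_ifs with hj
      · simp
      · simp_rw [hcoord]
        simp [Q, ω, collapse_same, collapse_of_ne hj]
        ring
    unfold crossSum
    simp_rw [this]
    rw [← Finset.mul_sum, ← Nat.cast_sum]
    exact inv_mul_cancel_right₀ hN _
  refine ⟨ofTable Q hQ, ?_⟩
  rw [blockDataLinear_apply]
  funext o
  rw [← hsum o, Fintype.sum_option]
  cases o with
  | none =>
    simp only [blockData, outSum, hcross, hdiag, zero_add]
    exact Finset.sum_congr rfl fun v _ => hsymm _ _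
  | some v =>
    simp only [blockData]
    rw [sum_coord_eq, hcross, add_comm]
    congr 1
    refine Finset.sum_congr rfl fun w _ => ?_
    rw [hcoord]
    simp [Q, ω, collapse_same]

theorem generically_outSum_ne_zero (hk : 1 < k) (hn : ∀ i, 0 < n i) (i : Fin k) :
    Generically (fun u : Dyad n → ℂ => outSum u i ≠ 0) := by
  refine (generically_linearMap_ne_zero (∑ v, crossLinear i v) 1 ?_).mono fun u hu => ?_
  · have h1 : ∀ v, crossSum (1 : Dyad n → ℂ) i v = outCard n i := fun v => by
      unfold crossSum outCard
      rw [Nat.cast_sum]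
      refine Finset.sum_congr rfl fun j _ => ?_
      split_ifs with hj
      · simp
      · rw [Finset.sum_congr rfl fun w _ => coord_of_ne _ (mk_ne_of_ne (Ne.symm hj) v w)]
        simp
    simp only [LinearMap.sum_apply, crossLinear_apply, h1, Finset.sum_const, Finset.card_univ,
      Fintype.card_fin, nsmul_eq_mul]
    exact mul_ne_zero (Nat.cast_ne_zero.mpr (hn i).ne')
      (Nat.cast_ne_zero.mpr (outCard_pos hk hn i).ne')
  · simpa only [outSum, LinearMap.sum_apply, crossLinear_apply] using hu

theorem generically_encard_blockData (hk : 1 < k) (hn : ∀ i, 0 < n i) (i : Fin k) :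
    Generically (fun u : Dyad n → ℂ =>
      (blockSolutions (blockData u i)).encard = oneBlockDegree (n i + 1)) := by
  have hcard : Fintype.card (Option (Fin (n i))) = n i + 1 := by simp
  unfold oneBlockDegree
  split_ifs with h
  · refine generically_of_forall fun u => ?_
    rw [encard_blockSolutions_of_card_eq_two (hcard.trans h)]
    · rfl
    -- a block with one vertex: both row sums are the sum to the other blocks
    have h1 : Subsingleton (Fin (n i)) := Fin.subsingleton_iff_le_one.mpr (by omega)
    have key : ∀ v, blockData u i (some v) = blockData u i none := fun v => by
      simp only [blockData]
      rw [sum_coord_eq, outSum, Finset.sum_eq_zero, zero_add]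
      · exact (Fintype.sum_subsingleton _ v).symm
      · intro w _
        rw [Subsingleton.elim w v, coord_self]
    intro x y
    rcases x with _ | x <;> rcases y with _ | y <;> simp [key]
  · have := hn i
    have h3 := generically_encard_blockSolutions (V := Option (Fin (n i))) (by omega)
    rw [hcard] at h3
    refine (h3.comp_linearMap (blockDataLinear i)
      (blockDataLinear_surjective hk hn i (by omega))).mono fun u hu => ?_
    rwa [blockDataLinear_apply] at hu

theorem hasMLDegree_of_one_lt (hk : 1 < k) (hn : ∀ i, 0 < n i) :
    HasMLDegree n (∏ i, oneBlockDegree (n i + 1)) := by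
  refine ((Generically.forall (generically_outSum_ne_zero hk hn)).and
    (Generically.forall (generically_encard_blockData hk hn))).mono fun u hu => ?_
  have hbij := bijOn_blockTable hu.1
  rw [← encard_univ_pi _ _ hu.2, ← hbij.image_eq, hbij.injOn.encard_image]

theorem HasMLDegree.mlDeg_eq {d : ℕ} (h : HasMLDegree n d) : MLdeg n = d := by
  have h' : ∃ d, HasMLDegree n d := ⟨d, h⟩
  rw [MLdeg, dif_pos h']
  exact h'.choose_spec.unique h

theorem two_pow_sub_one_ge (n : ℕ) (hn : 1 ≤ n) : n ≤ 2 ^ (n - 1) := by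
  have := Nat.lt_two_pow_self (n := n - 1)
  omega

theorem mlDeg_one_block (m : ℕ) (hm : 1 < m) : MLdeg ![m] = oneBlockDegree m := by
  have h := hasMLDegree_of_subsingleton (n := ![m]) (by simpa using Nat.succ_le_of_lt hm)
  rw [h.mlDeg_eq]
  simp

theorem mlDeg_block_one (m : ℕ) (hm : 0 < m) : MLdeg ![m, 1] = oneBlockDegree (m + 1) := by
  have h := hasMLDegree_of_one_lt (n := ![m, 1]) (by norm_num)
    (fun i => by fin_cases i <;> simp [hm])
  rw [h.mlDeg_eq, Fin.prod_univ_two]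
  simp [oneBlockDegree]

end Count

end BetaSBM

theorem mainTheorem1 :
    (∀ (k : ℕ) (n : Fin k → ℕ), (∀ i, 0 < n i) → 2 ≤ ∑ i, n i →
      BetaSBM.HasMLDegree n (BetaSBM.MLdeg n)) ∧
    (∀ n : ℕ, 1 < n →
      (BetaSBM.MLdeg ![n] : ℤ) = if n = 2 then 1 else 2 ^ (n - 1) - (n : ℤ)) ∧
    (∀ n₁ : ℕ, 0 < n₁ → BetaSBM.MLdeg ![n₁, 1] = BetaSBM.MLdeg ![n₁ + 1]) ∧
    (∀ (k : ℕ) (n : Fin k → ℕ), 1 < k → (∀ i, 0 < n i) →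
      BetaSBM.MLdeg n = ∏ i, BetaSBM.MLdeg ![n i, 1]) := by
  refine ⟨fun k n hn h2 => ?_, fun n hn => ?_, fun n₁ hn => ?_, fun k n hk hn => ?_⟩
  · rcases Nat.lt_or_ge 1 k with hk | hk
    · have h := BetaSBM.hasMLDegree_of_one_lt hk hn
      rwa [h.mlDeg_eq]
    · have : Subsingleton (Fin k) := Fin.subsingleton_iff_le_one.mpr hk
      have h := BetaSBM.hasMLDegree_of_subsingleton h2
      rwa [h.mlDeg_eq]
  · rw [BetaSBM.mlDeg_one_block n hn, BetaSBM.oneBlockDegree]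
    split_ifs with h
    · rfl
    · rw [Nat.cast_sub (BetaSBM.two_pow_sub_one_ge n hn.le)]
      push_cast
      rfl
  · rw [BetaSBM.mlDeg_block_one n₁ hn, BetaSBM.mlDeg_one_block (n₁ + 1) (by omega)]
  · rw [(BetaSBM.hasMLDegree_of_one_lt hk hn).mlDeg_eq]
    exact Finset.prod_congr rfl fun i _ => (BetaSBM.mlDeg_block_one (n i) (hn i)).symm
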